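/- Let $G$ be a finite digraph (parallel edges and loops are allowed) with $n$ vertices, $m$ edges and a source vertex $s$, and let $k\ge 0$ be an integer. A spanning subgraph $H$ of $G$ is a $k$-FTRS of $G$ if for every set $F$ of at most $k$ edges of $G$ and every vertex $v$, there is a path from $s$ to $v$ in $G-F$ if and only if there is one in $H-F$. For a spanning subgraph $A$ of $G$ and a vertex $v\ne s$, an $(s,v)$-cut of $A$ is a set $X\subseteq E(A)$ such that $A-X$ has no path from $s$ to $v$; $R_X$ is the set of vertices reachable from $s$ in $A-X$; and $X$ is an important $(s,v)$-separator of $A$ if it is an $(s,v)$-cut and there is no other $(s,v)$-cut $X'$ of $A$ with $|X'|\le |X|$ and $R_X\subseteq R_{X'}$. Then $G$ has a $k$-FTRS $H$ in which every vertex has in-degree at most $(k+1)\,4^{k+1}$, and which is obtained from $G$ by deleting all incoming edges of $s$ and then repeatedly deleting, from the current graph $A$, an edge $e$ of $A$ whose head is some vertex $v\neq s$ and which lies in no important $(s,v)$-separator of $A$ of size at most $k+1$. Moreover, there is an algorithm that, given $(G,s,k)$ with $G$ as a list of edges, constructs such an $H$ (as the characteristic vector of its edge set) in time $\mathcal{O}\big(1+4^k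 (k+1)^2 (m+n)\,m\big)$, with an absolute constant; for $k\ge 1$ and $m\ge 1$ this is $\mathcal{O}(4^k k^2(m+n)m)$. The algorithm is a fixed program of a random access machine with unit-cost addition, subtraction, comparison and indirect memory access on words of $\mathcal{O}(\log(n+m+k+2))$ bits. -/

import Mathlib

/-! ## Digraphs, cuts, important separators, fault tolerant reachability subgraphs -/

/-- A directed graph with vertex type `V` and edge type `E`; every edge has a tail and a head.
Parallel edges and loops are allowed. A spanning subgraph is given by its set of edges. -/
structure MDigraph (V E : Type*) where
  tail : E → V
  head : E → V

namespace MDigraph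

variable {V E : Type*}

/-- There is a directed path from `u` to `v` in the spanning subgraph with edge set `A`. -/
def Reach (G : MDigraph V E) (A : Finset E) (u v : V) : Prop :=
  Relation.ReflTransGen (fun a b => ∃ e ∈ A, G.tail e = a ∧ G.head e = b) u v

/-- `X` is a set of edges of the subgraph `A`, and there is no path from `s` to `v` in `A - X`. -/
def IsCut [DecidableEq E] (G : MDigraph V E) (A : Finset E) (s v : V) (X : Finset E) : Prop :=
  X ⊆ A ∧ ¬ G.Reach (A \ X) s v

/-- The reachability set `R_X`: all vertices reachable from `s` in `A - X`. -/
def reachSet [DecidableEq E] (G : MDigraph V E) (A : Finset E) (s : V) (X : Finset E) : Set V :=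
  {u | G.Reach (A \ X) s u}

/-- `X` is an important `(s, v)`-separator of the subgraph `A`: it is an `(s, v)`-cut and there is
no other `(s, v)`-cut `X'` with `|X'| ≤ |X|` and `R_X ⊆ R_X'`. -/
def IsImportantSeparator [DecidableEq E] (G : MDigraph V E) (A : Finset E) (s v : V)
    (X : Finset E) : Prop :=
  G.IsCut A s v X ∧
    ∀ X' : Finset E, G.IsCut A s v X' → X'.card ≤ X.card →
      G.reachSet A s X ⊆ G.reachSet A s X' → X' = X

/-- The set of edges of the subgraph `A` with head `v`. -/
def inEdges [DecidableEq V] (G : MDigraph V E) (A : Finset E) (v : V) : Finset E :=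
  A.filter (fun e => G.head e = v)

/-- The spanning subgraph `H` is a `k`-fault tolerant reachability subgraph of `G` with respect to
the source `s` (for edge failures). -/
def IsFTRS [Fintype E] [DecidableEq E] (G : MDigraph V E) (s : V) (k : ℕ) (H : Finset E) : Prop :=
  ∀ F : Finset E, F.card ≤ k → ∀ v : V,
    (G.Reach (Finset.univ \ F) s v ↔ G.Reach (H \ F) s v)

/-- One deletion: `B = A - e`, where `e` is an incoming edge in `A` of some vertex `v ≠ s`, and `e`
lies in no important `(s, v)`-separator of `A` of size at most `k + 1`. -/
def DeletionStep [DecidableEq V] [DecidableEq E] (G : MDigraph V E) (s : V) (k : ℕ)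
    (A B : Finset E) : Prop :=
  ∃ v : V, v ≠ s ∧ ∃ e ∈ G.inEdges A v,
    (∀ X : Finset E, G.IsImportantSeparator A s v X → X.card ≤ k + 1 → e ∉ X) ∧ B = A.erase e

/-- `H` arises from `G` by first deleting all incoming edges of the source `s` and then performing
finitely many deletion steps. -/
def ObtainedByDeletions [Fintype E] [DecidableEq V] [DecidableEq E] (G : MDigraph V E) (s : V)
    (k : ℕ) (H : Finset E) : Prop :=
  Relation.ReflTransGen (G.DeletionStep s k) (Finset.univ \ G.inEdges Finset.univ s) H

end MDigraph

/-! ## A random access machine with bounded words -/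

namespace RAM

/-- Programs of the machine. It has registers and an unbounded random access memory, all holding
natural numbers; a program mentions only finitely many registers. -/
inductive Prog : Type where
  /-- do nothing -/
  | skip : Prog
  /-- `x := c` -/
  | const (x c : ℕ) : Prog
  /-- `x := y + z` -/
  | add (x y z : ℕ) : Prog
  /-- `x := y - z`, truncated at zero -/
  | sub (x y z : ℕ) : Prog
  /-- `x := memory[y]` -/
  | load (x y : ℕ) : Prog
  /-- `memory[x] := y` -/
  | store (x y : ℕ) : Prog
  /-- sequential composition -/
  | seq (p q : Prog) : Prog
  /-- `if x < y then p else q` -/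
  | ite (x y : ℕ) (p q : Prog) : Prog
  /-- `while x < y do p` -/
  | while (x y : ℕ) (p : Prog) : Prog

/-- A state of the machine: the contents of the registers and of the memory. -/
@[ext] structure State where
  reg : ℕ → ℕ
  mem : ℕ → ℕ

/-- Write the value `a` to register `x`. -/
def State.setReg (σ : State) (x a : ℕ) : State := ⟨Function.update σ.reg x a, σ.mem⟩

/-- Write the value `b` to memory cell `a`. -/
def State.setMem (σ : State) (a b : ℕ) : State := ⟨σ.reg, Function.update σ.mem a b⟩

/-- `Exec W p σ τ t`: on the machine whose words hold the numbers below `W`, the program `p` started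
in state `σ` halts in state `τ` after exactly `t` steps. Every executed instruction and every
evaluation of a test is one step; an operation whose result does not fit into a word gets stuck. -/
inductive Exec (W : ℕ) : Prog → State → State → ℕ → Prop where
  | skip (σ : State) : Exec W .skip σ σ 1
  | const (σ : State) (x c : ℕ) : c < W → Exec W (.const x c) σ (σ.setReg x c) 1
  | add (σ : State) (x y z : ℕ) : σ.reg y + σ.reg z < W →
      Exec W (.add x y z) σ (σ.setReg x (σ.reg y + σ.reg z)) 1
  | sub (σ : State) (x y z : ℕ) : Exec W (.sub x y z) σ (σ.setReg x (σ.reg y - σ.reg z)) 1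
  | load (σ : State) (x y : ℕ) : Exec W (.load x y) σ (σ.setReg x (σ.mem (σ.reg y))) 1
  | store (σ : State) (x y : ℕ) : Exec W (.store x y) σ (σ.setMem (σ.reg x) (σ.reg y)) 1
  | seq {p q : Prog} {σ σ' τ : State} {t₁ t₂ : ℕ} :
      Exec W p σ σ' t₁ → Exec W q σ' τ t₂ → Exec W (.seq p q) σ τ (t₁ + t₂)
  | ite_true {p q : Prog} {x y : ℕ} {σ τ : State} {t : ℕ} : σ.reg x < σ.reg y →
      Exec W p σ τ t → Exec W (.ite x y p q) σ τ (t + 1)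
  | ite_false {p q : Prog} {x y : ℕ} {σ τ : State} {t : ℕ} : ¬ σ.reg x < σ.reg y →
      Exec W q σ τ t → Exec W (.ite x y p q) σ τ (t + 1)
  | while_true {p : Prog} {x y : ℕ} {σ σ' τ : State} {t₁ t₂ : ℕ} : σ.reg x < σ.reg y →
      Exec W p σ σ' t₁ → Exec W (.while x y p) σ' τ t₂ →
      Exec W (.while x y p) σ τ (t₁ + t₂ + 1)
  | while_false {p : Prog} {x y : ℕ} {σ : State} : ¬ σ.reg x < σ.reg y →
      Exec W (.while x y p) σ σ 1

/-- The input `(G, s, k)`: registers `0, 1, 2, 3` hold `n, m, k, s`, and the memory holds the list of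
edges, the tail of edge `i` in cell `2 * i` and its head in cell `2 * i + 1`. Everything else is
zero. -/
def inputState {n m : ℕ} (G : MDigraph (Fin n) (Fin m)) (s : Fin n) (k : ℕ) : State where
  reg := fun x =>
    if x = 0 then n else if x = 1 then m else if x = 2 then k else if x = 3 then (s : ℕ) else 0
  mem := fun a =>
    if h : a / 2 < m then
      if a % 2 = 0 then (G.tail ⟨a / 2, h⟩ : ℕ) else (G.head ⟨a / 2, h⟩ : ℕ)
    else 0

/-- The output: memory cell `i` holds `1` if edge `i` belongs to `H`, and `0` otherwise. -/
def HasOutput {m : ℕ} (τ : State) (H : Finset (Fin m)) : Prop :=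
  ∀ i : Fin m, τ.mem i = if i ∈ H then 1 else 0

end RAM

universe u v

set_option linter.unusedSectionVars false
set_option linter.constructorNameAsVariable false

/-! Fix a vertex `t ≠ s`. It suffices to discard all but few edges into `t` such that, under any `k`
faults, `t` stays reachable whenever it was. Reachability of the other vertices then survives too
(`reach_of_preserves`), and the edges can be removed one by one in legitimate steps: an edge `e` of
an important separator `X` of size at most `k + 1` is indispensable under the faults `X - e`
(`not_mem_importantSeparator`, `deletionSteps_of_preserves`).

The edges kept are those carrying a flow into `t` that is built in `k + 1` rounds from supplies at
the vertices, initially `k + 1` units at `s`. A round computes a maximum flow and the largest source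
side `R` of a minimum cut, then adds one unit at the head of every edge leaving `R`. At most as many
edges leave `R` as the flow has units, so the supply at most doubles, and at most `(k + 1) * 2 ^ (k
+ 1)` edges into `t` carry flow at the end. Augmenting never takes flow off an edge into `t`.

The reason that this suffices is the invariant `Linked`. Take a path to `t` through a vertex set `Z`
whose last edge `e₀` carries no flow. The tail of `e₀` is not in `R`, since edges leaving `R` are
saturated; so if `s` is in `R`, the path leaves `R` at a vertex of `Z` that receives a new unit. By
submodularity, minimum cuts for smaller supplies lie inside `R` (`IsFlow.subset_of_minimum`), so
this unit raises all of them (`Linked.succ`). Finally some supplies inside `Z` make all cuts at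
least `k + 1`. If `k` faults disconnected `t` after the deletion, the set `Z` still reachable would
be a cut of value at most `k`, and uncrossing it with `R` would give a cut below the flow value
(`Linked.preserves`).

One backward search in the residual graph takes time linear in `n + m`, and every search either
augments the flow or ends a round. The main loop runs over the edges and treats their heads, which
gives the factor `m`. The program is verified in a small language with named registers and arrays,
with running times, and compiled to the machine with overhead factor `8`. Its correctness also
yields the existence statement, by transport along an isomorphism. -/

namespace MDigraph

/-! ### Legitimate deletions and preservation of reachability -/

section Deletions

variable {V E : Type*} [DecidableEq E] {G : MDigraph V E} {s : V} {k : ℕ}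

theorem Reach.mono {A B : Finset E} (h : A ⊆ B) {u v : V} (hr : G.Reach A u v) :
    G.Reach B u v := by
  induction hr with
  | refl => exact Relation.ReflTransGen.refl
  | tail _ hxy ih =>
    obtain ⟨e, he, h'⟩ := hxy
    exact ih.tail ⟨e, h he, h'⟩

/-- If `e ∈ X`, then `X - e` is smaller and reaches at least as much, so importance prevents it from
being a cut. The hypothesis for these at most `k` faults then gives a path avoiding all of `X`. -/
theorem not_mem_importantSeparator {A : Finset E} {v : V} {e : E}
    (h : ∀ F : Finset E, F.card ≤ k → G.Reach (A \ F) s v → G.Reach (A.erase e \ F) s v)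
    (X : Finset E) (hX : G.IsImportantSeparator A s v X) (hk : X.card ≤ k + 1) : e ∉ X := by
  intro he
  have hc := Finset.card_erase_of_mem he
  have hr : G.Reach (A \ X.erase e) s v := by
    by_contra hr
    have := hX.2 (X.erase e) ⟨(Finset.erase_subset _ _).trans hX.1.1, hr⟩ (by omega)
      (fun u hu => Reach.mono (Finset.sdiff_subset_sdiff le_rfl (Finset.erase_subset _ _)) hu)
    rw [← this] at he
    exact Finset.notMem_erase e X he
  refine hX.1.2 (Reach.mono ?_ (h _ (by omega) hr))
  intro a
  simp only [Finset.mem_sdiff, Finset.mem_erase]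
  tauto

/-- All lost edges end in `v`, so a path is repaired by replacing its part up to `v`. -/
theorem reach_of_preserves {A A' : Finset E} {v : V} {F : Finset E}
    (hhead : ∀ e ∈ A, e ∉ A' → G.head e = v)
    (hpres : G.Reach (A \ F) s v → G.Reach (A' \ F) s v) {w : V}
    (hw : G.Reach (A \ F) s w) : G.Reach (A' \ F) s w := by
  induction hw with
  | refl => exact Relation.ReflTransGen.refl
  | tail hx hxy ih =>
    obtain ⟨e, he, h1, h2⟩ := hxy
    rw [Finset.mem_sdiff] at he
    by_cases heA : e ∈ A'
    · exact ih.tail ⟨e, Finset.mem_sdiff.2 ⟨heA, he.2⟩, h1, h2⟩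
    · have hv := hhead e he.1 heA
      rw [← h2, hv]
      exact hpres (hv ▸ hx.tail ⟨e, Finset.mem_sdiff.2 he, h1, rfl⟩)

/-- Every intermediate graph lies between `A'` and `A` and hence inherits preservation, so any order
of deletion is legitimate. -/
theorem deletionSteps_of_preserves [DecidableEq V] {A A' : Finset E} {v : V} (hv : v ≠ s)
    (hsub : A' ⊆ A) (hhead : ∀ e ∈ A, e ∉ A' → G.head e = v)
    (hpres : ∀ F : Finset E, F.card ≤ k → G.Reach (A \ F) s v → G.Reach (A' \ F) s v) :
    Relation.ReflTransGen (G.DeletionStep s k) A A' := by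
  induction hN : (A \ A').card generalizing A with
  | zero =>
    rw [Finset.card_eq_zero, Finset.sdiff_eq_empty_iff_subset] at hN
    rw [hN.antisymm hsub]
  | succ N ih =>
    obtain ⟨e, he⟩ : (A \ A').Nonempty := Finset.card_pos.1 (by omega)
    have he' := Finset.mem_sdiff.1 he
    have hs : A' ⊆ A.erase e := fun a ha =>
      Finset.mem_erase.2 ⟨fun h => he'.2 (h ▸ ha), hsub ha⟩
    refine Relation.ReflTransGen.head (b := A.erase e) ⟨v, hv, e, ?_, ?_, rfl⟩ (ih hs ?_ ?_ ?_)
    · exact Finset.mem_filter.2 ⟨he'.1, hhead e he'.1 he'.2⟩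
    · exact not_mem_importantSeparator fun F hF hr =>
        (hpres F hF hr).mono (Finset.sdiff_subset_sdiff hs le_rfl)
    · exact fun a ha ha' => hhead a (Finset.mem_of_mem_erase ha) ha'
    · exact fun F hF hr => hpres F hF
        (hr.mono (Finset.sdiff_subset_sdiff (Finset.erase_subset _ _) le_rfl))
    · have : A.erase e \ A' = (A \ A').erase e := by
        ext a
        simp only [Finset.mem_sdiff, Finset.mem_erase]
        tauto
      rw [this, Finset.card_erase_of_mem he, hN]
      rfl

theorem reach_sdiff_inEdges_source [DecidableEq V] {A F : Finset E} {w : V}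
    (hw : G.Reach (A \ F) s w) : G.Reach ((A \ G.inEdges A s) \ F) s w :=
  reach_of_preserves (v := s)
    (fun e he hne => by
      by_contra h
      exact hne (Finset.mem_sdiff.2 ⟨he, fun h' => h (Finset.mem_filter.1 h').2⟩))
    (fun _ => Relation.ReflTransGen.refl) hw

end Deletions

/-! ### Cuts and unit flows with supplies at the vertices -/

section Flow

variable {V E : Type*} [Fintype V] [DecidableEq V]
  {G : MDigraph V E} {A f : Finset E} {s t : V} {k i : ℕ} {u tok c β : V → ℕ}

/-- The capacity of the cut `S` towards `t` in the graph `A` in which every vertex `y` has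
`c y` additional edges from a super source. -/
def cutValue (G : MDigraph V E) (A : Finset E) (c : V → ℕ) (t : V) (S : Finset V) : ℕ :=
  (∑ e ∈ A, if G.tail e ∈ S ∧ G.head e ∉ S then 1 else 0) +
    ∑ y, if y ∉ S ∧ y ≠ t then c y else 0

theorem cutValue_submodular (S R : Finset V) :
    G.cutValue A c t (S ∪ R) + G.cutValue A c t (S ∩ R) ≤
      G.cutValue A c t S + G.cutValue A c t R := by
  have h1 : (∑ e ∈ A, if G.tail e ∈ S ∪ R ∧ G.head e ∉ S ∪ R then 1 else 0) +
      (∑ e ∈ A, if G.tail e ∈ S ∩ R ∧ G.head e ∉ S ∩ R then 1 else 0) ≤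
      (∑ e ∈ A, if G.tail e ∈ S ∧ G.head e ∉ S then 1 else 0) +
      (∑ e ∈ A, if G.tail e ∈ R ∧ G.head e ∉ R then 1 else 0) := by
    rw [← Finset.sum_add_distrib, ← Finset.sum_add_distrib]
    refine Finset.sum_le_sum fun e _ => ?_
    by_cases h1 : G.tail e ∈ S <;> by_cases h2 : G.tail e ∈ R <;>
      by_cases h3 : G.head e ∈ S <;> by_cases h4 : G.head e ∈ R <;> simp [h1, h2, h3, h4]
  have h2 : (∑ y, if y ∉ S ∪ R ∧ y ≠ t then c y else 0) +
      (∑ y, if y ∉ S ∩ R ∧ y ≠ t then c y else 0) =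
      (∑ y, if y ∉ S ∧ y ≠ t then c y else 0) +
      (∑ y, if y ∉ R ∧ y ≠ t then c y else 0) := by
    rw [← Finset.sum_add_distrib, ← Finset.sum_add_distrib]
    refine Finset.sum_congr rfl fun y _ => ?_
    by_cases h1 : y ∈ S <;> by_cases h2 : y ∈ R <;> by_cases h3 : y = t <;> simp [h1, h2, h3]
  unfold cutValue
  omega

/-- Passing from `R` to `S` saves the supplies in `S \ R`, and these are larger for `c` than for
`β`. Thus a gain proved by uncrossing with `β` carries over to the full supplies. -/
theorem cutValue_antitone_defect (hβ : ∀ y, β y ≤ c y) {S R : Finset V} (h : R ⊆ S) :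
    G.cutValue A c t S + G.cutValue A β t R ≤ G.cutValue A c t R + G.cutValue A β t S := by
  have h2 : (∑ y, if y ∉ S ∧ y ≠ t then c y else 0) +
      (∑ y, if y ∉ R ∧ y ≠ t then β y else 0) ≤
      (∑ y, if y ∉ R ∧ y ≠ t then c y else 0) +
      (∑ y, if y ∉ S ∧ y ≠ t then β y else 0) := by
    rw [← Finset.sum_add_distrib, ← Finset.sum_add_distrib]
    refine Finset.sum_le_sum fun y _ => ?_
    have := hβ y
    by_cases h1 : y ∈ S <;> by_cases h2 : y ∈ R <;> by_cases h3 : y = t <;>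
      simp [h1, h2, h3, this]
    exact absurd (h h2) h1
  unfold cutValue
  omega

/-- `f` is the edge set of a unit flow into `t` in `A` that is fed with `u y` units at every
vertex `y`. -/
structure IsFlow (G : MDigraph V E) (A f : Finset E) (t : V) (u : V → ℕ) : Prop where
  sub : f ⊆ A
  cons : ∀ y, y ≠ t → (f.filter (fun e => G.tail e = y)).card =
    (f.filter (fun e => G.head e = y)).card + u y
  noOut : ∀ e ∈ f, G.tail e ≠ t

/-- Like `IsFlow`, but one unit of the supply still waits at `w`. -/
structure IsPendingFlow (G : MDigraph V E) (A f : Finset E) (t : V) (u : V → ℕ) (w : V) :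
    Prop where
  sub : f ⊆ A
  cons : ∀ y, y ≠ t → (f.filter (fun e => G.tail e = y)).card + (if y = w then 1 else 0) =
    (f.filter (fun e => G.head e = y)).card + u y
  noOut : ∀ e ∈ f, G.tail e ≠ t

theorem IsFlow.pending (hf : G.IsFlow A f t u) (w : V) :
    G.IsPendingFlow A f t (fun y => u y + if y = w then 1 else 0) w :=
  ⟨hf.sub, fun y hy => by rw [hf.cons y hy, add_assoc], hf.noOut⟩

theorem IsPendingFlow.isFlow (hf : G.IsPendingFlow A f t u t) : G.IsFlow A f t u :=
  ⟨hf.sub, fun y hy => by rw [← hf.cons y hy, if_neg hy, add_zero], hf.noOut⟩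

theorem card_filter_insert_eq [DecidableEq E] {e : E} (he : e ∉ f) (g : E → V) (y : V) :
    ((insert e f).filter (fun e => g e = y)).card =
      (f.filter (fun e => g e = y)).card + if y = g e then 1 else 0 := by
  rw [Finset.filter_insert]
  by_cases h : g e = y
  · rw [if_pos h, if_pos h.symm, Finset.card_insert_of_notMem (by simp [he])]
  · rw [if_neg h, if_neg (Ne.symm h), add_zero]

/-- Using a free edge here, and cancelling a used one in `IsPendingFlow.erase`, moves the waiting
unit along one residual arc. An augmenting path can therefore be treated arc by arc. -/
theorem IsPendingFlow.insert [DecidableEq E] {w : V} (hf : G.IsPendingFlow A f t u w) {e : E}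
    (heA : e ∈ A) (he : e ∉ f) (hw : G.tail e = w) (hwt : w ≠ t) :
    G.IsPendingFlow A (insert e f) t u (G.head e) := by
  refine ⟨Finset.insert_subset heA hf.sub, fun y hy => ?_, fun e' he' => ?_⟩
  · have := hf.cons y hy
    rw [card_filter_insert_eq he, card_filter_insert_eq he, hw]
    omega
  · obtain rfl | h := Finset.mem_insert.1 he'
    · exact hw ▸ hwt
    · exact hf.noOut e' h

theorem IsPendingFlow.erase [DecidableEq E] {w : V} (hf : G.IsPendingFlow A f t u w) {e : E}
    (he : e ∈ f) (hw : G.head e = w) :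
    G.IsPendingFlow A (f.erase e) t u (G.tail e) := by
  refine ⟨(Finset.erase_subset _ _).trans hf.sub, fun y hy => ?_,
    fun e' he' => hf.noOut e' (Finset.mem_of_mem_erase he')⟩
  have h1 := hf.cons y hy
  have h2 := card_filter_insert_eq (Finset.notMem_erase e f) G.tail y
  have h3 := card_filter_insert_eq (Finset.notMem_erase e f) G.head y
  rw [Finset.insert_erase he] at h2 h3
  rw [hw] at h3
  omega

/-- There are no residual arcs from outside `S` to `S`, and no unused supply outside `S`. -/
def Tight (G : MDigraph V E) (A f : Finset E) (t : V) (tok : V → ℕ) (S : Finset V) : Prop :=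
  (∀ e ∈ A, G.tail e ∈ S → G.head e ∉ S → e ∈ f) ∧
    (∀ e ∈ f, G.head e ∈ S → G.tail e ∈ S) ∧ ∀ y, y ∉ S → y ≠ t → tok y = 0

/-- Sum the conservation law over `S`; edges inside `S` cancel. -/
theorem IsFlow.sum_eq (hf : G.IsFlow A f t u) {S : Finset V} (hS : t ∉ S) :
    (∑ e ∈ f, if G.tail e ∈ S ∧ G.head e ∉ S then 1 else 0) =
      (∑ e ∈ f, if G.tail e ∉ S ∧ G.head e ∈ S then 1 else 0) + ∑ y ∈ S, u y := by
  have h1 : ∑ y ∈ S, (f.filter (fun e => G.tail e = y)).card =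
      ∑ y ∈ S, (f.filter (fun e => G.head e = y)).card + ∑ y ∈ S, u y := by
    rw [← Finset.sum_add_distrib]
    exact Finset.sum_congr rfl fun y hy => hf.cons y fun h => hS (h ▸ hy)
  have key : ∀ g : E → V, ∑ y ∈ S, (f.filter (fun e => g e = y)).card =
      ∑ e ∈ f, if g e ∈ S then 1 else 0 := by
    intro g
    simp only [Finset.card_filter]
    rw [Finset.sum_comm]
    exact Finset.sum_congr rfl fun e _ => by simp
  rw [key, key] at h1
  have h2 : (∑ e ∈ f, if G.tail e ∈ S ∧ G.head e ∉ S then 1 else 0) +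
      (∑ e ∈ f, if G.head e ∈ S then 1 else 0) =
      (∑ e ∈ f, if G.tail e ∉ S ∧ G.head e ∈ S then 1 else 0) +
      (∑ e ∈ f, if G.tail e ∈ S then 1 else 0) := by
    rw [← Finset.sum_add_distrib, ← Finset.sum_add_distrib]
    refine Finset.sum_congr rfl fun e _ => ?_
    by_cases h1 : G.tail e ∈ S <;> by_cases h2 : G.head e ∈ S <;> simp [h1, h2]
  omega

theorem sum_ne_split (u : V → ℕ) {S : Finset V} (hS : t ∉ S) :
    (∑ y, if y ≠ t then u y else 0) =
      (∑ y ∈ S, u y) + ∑ y, if y ∉ S ∧ y ≠ t then u y else 0 := by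
  have : ∑ y ∈ S, u y = ∑ y, if y ∈ S then u y else 0 := by simp
  rw [this, ← Finset.sum_add_distrib]
  refine Finset.sum_congr rfl fun y _ => ?_
  by_cases h2 : y = t
  · simp [h2, hS]
  · by_cases h1 : y ∈ S <;> simp [h1, h2]

theorem cutValue_add (S : Finset V) :
    G.cutValue A (fun y => u y + tok y) t S =
      G.cutValue A u t S + ∑ y, if y ∉ S ∧ y ≠ t then tok y else 0 := by
  unfold cutValue
  rw [add_assoc, ← Finset.sum_add_distrib]
  congr 1
  refine Finset.sum_congr rfl fun y _ => ?_
  split_ifs <;> rfl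

theorem sum_sub_le {p : E → Prop} [DecidablePred p] (h : f ⊆ A) :
    (∑ e ∈ f, if p e then 1 else 0) ≤ ∑ e ∈ A, if p e then 1 else 0 :=
  Finset.sum_le_sum_of_subset h

theorem IsFlow.le_cutValue (hf : G.IsFlow A f t u) {S : Finset V} (hS : t ∉ S)
    (tok : V → ℕ) :
    (∑ y, if y ≠ t then u y else 0) ≤ G.cutValue A (fun y => u y + tok y) t S := by
  have h1 := hf.sum_eq hS
  have h2 := sum_ne_split u hS
  have h3 := sum_sub_le (p := fun e => G.tail e ∈ S ∧ G.head e ∉ S) hf.sub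
  rw [cutValue_add]
  unfold cutValue
  omega

theorem IsFlow.cutValue_eq (hf : G.IsFlow A f t u) {S : Finset V} (hS : t ∉ S)
    (hT : G.Tight A f t tok S) :
    G.cutValue A (fun y => u y + tok y) t S = ∑ y, if y ≠ t then u y else 0 := by
  have h1 := hf.sum_eq hS
  have h2 := sum_ne_split u hS
  have h3 : (∑ e ∈ A, if G.tail e ∈ S ∧ G.head e ∉ S then 1 else 0) =
      ∑ e ∈ f, if G.tail e ∈ S ∧ G.head e ∉ S then 1 else 0 := by
    symm
    refine Finset.sum_subset hf.sub fun e he hef => if_neg fun h => hef (hT.1 e he h.1 h.2)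
  have h4 : (∑ e ∈ f, if G.tail e ∉ S ∧ G.head e ∈ S then 1 else 0) = 0 :=
    Finset.sum_eq_zero fun e he => if_neg fun h => h.1 (hT.2.1 e he h.2)
  have h5 : (∑ y, if y ∉ S ∧ y ≠ t then tok y else 0) = 0 :=
    Finset.sum_eq_zero fun y _ => by
      split_ifs with h
      · exact hT.2.2 y h.1 h.2
      · rfl
  rw [cutValue_add]
  unfold cutValue
  omega

/-- Equality in weak duality makes every slack vanish: unused edges out of `S`, flow into `S`,
unused supply outside. With `IsFlow.cutValue_eq`, the tight sets are exactly the cuts whose value is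
that of the flow. -/
theorem IsFlow.tight_of_le (hf : G.IsFlow A f t u) {S : Finset V} (hS : t ∉ S)
    (hle : G.cutValue A (fun y => u y + tok y) t S ≤ ∑ y, if y ≠ t then u y else 0) :
    G.Tight A f t tok S := by
  have h1 := hf.sum_eq hS
  have h2 := sum_ne_split u hS
  have h3 := sum_sub_le (p := fun e => G.tail e ∈ S ∧ G.head e ∉ S) hf.sub
  rw [cutValue_add] at hle
  unfold cutValue at hle
  refine ⟨fun e he ht hh => ?_, fun e he hh => ?_, fun y hy hyt => ?_⟩
  · by_contra hef
    have : (∑ e ∈ f, if G.tail e ∈ S ∧ G.head e ∉ S then 1 else 0) <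
        ∑ e ∈ A, if G.tail e ∈ S ∧ G.head e ∉ S then 1 else 0 :=
      Finset.sum_lt_sum_of_subset hf.sub he hef (by simp [ht, hh]) (fun _ _ _ => Nat.zero_le _)
    omega
  · by_contra ht
    have : 0 < ∑ e ∈ f, if G.tail e ∉ S ∧ G.head e ∈ S then 1 else 0 :=
      Finset.sum_pos' (fun _ _ => Nat.zero_le _) ⟨e, he, by simp [ht, hh]⟩
    omega
  · have h0 : (∑ y, if y ∉ S ∧ y ≠ t then tok y else 0) = 0 := by omega
    have := Finset.sum_eq_zero_iff.1 h0 y (Finset.mem_univ _)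
    simpa [hy, hyt] using this

theorem IsFlow.card_inEdges (hf : G.IsFlow A f t u) :
    (G.inEdges f t).card = ∑ y, if y ≠ t then u y else 0 := by
  -- The cut that separates only `t`: everything crossing it enters `t`, and nothing returns.
  have h1 := hf.sum_eq (S := Finset.univ.erase t) (by simp)
  have h2 := sum_ne_split u (S := Finset.univ.erase t) (t := t) (by simp)
  have h3 : (∑ e ∈ f, if G.tail e ∉ Finset.univ.erase t ∧ G.head e ∈ Finset.univ.erase t
      then 1 else 0) = 0 := Finset.sum_eq_zero fun e he => if_neg fun h => by
        simpa [hf.noOut e he] using h.1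
  have h4 : (∑ e ∈ f, if G.tail e ∈ Finset.univ.erase t ∧ G.head e ∉ Finset.univ.erase t
      then 1 else 0) = (G.inEdges f t).card := by
    unfold inEdges
    rw [Finset.card_filter]
    refine Finset.sum_congr rfl fun e he => ?_
    simp [hf.noOut e he]
  have h5 : (∑ y, if y ∉ Finset.univ.erase t ∧ y ≠ t then u y else 0) = 0 :=
    Finset.sum_eq_zero fun y _ => if_neg fun h => by simp [h.2] at h
  omega

/-! ### The invariant of the rounds and its consequence for fault sets -/

/-- The invariant of the rounds: whenever `e₀` is the last edge of a path to `t` whose other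
vertices lie in `Z`, then `e₀` belongs to `f`, or some of the supplies `c`, all of them in `Z`,
suffice to make all cuts at least `i + 1`. -/
def Linked (G : MDigraph V E) (A f : Finset E) (s t : V) (k i : ℕ) (c : V → ℕ) : Prop :=
  ∀ (Z : Finset V), ∀ e₀ ∈ A, s ∈ Z → t ∉ Z → G.tail e₀ ∈ Z → G.head e₀ = t →
    (∀ R : Finset V, s ∈ R → G.tail e₀ ∉ R →
      ∃ e ∈ A, G.tail e ∈ R ∧ G.head e ∈ Z ∧ G.head e ∉ R) →
    e₀ ∈ f ∨ ∃ β : V → ℕ, (∀ y, β y ≤ c y) ∧ (∀ y, β y ≠ 0 → y ∈ Z) ∧ k + 1 ≤ β s ∧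
      ∀ S : Finset V, t ∉ S → i + 1 ≤ G.cutValue A β t S

theorem Linked.mono {f' : Finset E} (h : G.Linked A f s t k i c)
    (hf : ∀ e ∈ f, G.head e = t → e ∈ f') : G.Linked A f' s t k i c :=
  fun Z e₀ he hs ht htl hh hR => (h Z e₀ he hs ht htl hh hR).imp_left fun h => hf _ h hh

theorem supply_le_cutValue {S : Finset V} {y : V} (hy : y ∉ S) (hyt : y ≠ t) :
    β y ≤ G.cutValue A β t S := by
  have := Finset.single_le_sum (f := fun y => if y ∉ S ∧ y ≠ t then β y else 0)
    (fun _ _ => Nat.zero_le _) (Finset.mem_univ y)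
  rw [if_pos ⟨hy, hyt⟩] at this
  unfold cutValue
  omega

/-- With `k + 1` units at `s`, a cut without `s` pays for these, and a cut with `s` is crossed by
`e₀` or by the path leading to its tail. -/
theorem linked_zero (hst : s ≠ t) (hc : k + 1 ≤ c s) : G.Linked A f s t k 0 c := by
  intro Z e₀ he hs ht htl hh hR
  refine Or.inr ⟨fun y => if y = s then k + 1 else 0, ?_, ?_, ?_, ?_⟩
  · intro y
    by_cases h : y = s <;> simp [h, hc]
  · intro y
    by_cases h : y = s <;> simp [h, hs]
  · simp
  · intro S hS
    by_cases hsS : s ∈ S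
    · obtain ⟨e, heA, h1, h2⟩ : ∃ e ∈ A, G.tail e ∈ S ∧ G.head e ∉ S := by
        by_cases hx : G.tail e₀ ∈ S
        · exact ⟨e₀, he, hx, hh ▸ hS⟩
        · obtain ⟨e, heA, h1, -, h2⟩ := hR S hsS hx
          exact ⟨e, heA, h1, h2⟩
      have := Finset.single_le_sum
        (f := fun e => if G.tail e ∈ S ∧ G.head e ∉ S then 1 else 0)
        (fun _ _ => Nat.zero_le _) heA
      simp only [h1, h2, not_false_eq_true, and_self, if_true] at this
      unfold cutValue
      omega
    · have := supply_le_cutValue (G := G) (A := A)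
        (β := fun y => if y = s then k + 1 else 0) hsS hst
      simp only [if_true] at this
      omega

/-- A set is contained in the largest tight cut if it is a minimum cut for smaller supplies. -/
theorem IsFlow.subset_of_minimum (hf : G.IsFlow A f t u) {R : Finset V} (htR : t ∉ R)
    (hT : G.Tight A f t tok R) (hmax : ∀ S, t ∉ S → G.Tight A f t tok S → S ⊆ R)
    (hβ : ∀ y, β y ≤ u y + tok y) {S : Finset V} (hS : t ∉ S)
    (hmin : G.cutValue A β t S ≤ G.cutValue A β t (S ∩ R)) : S ⊆ R := by
  have h1 := cutValue_submodular (G := G) (A := A) (c := β) (t := t) S R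
  have h2 := cutValue_antitone_defect (G := G) (A := A) (c := fun y => u y + tok y) (t := t) hβ
    (Finset.subset_union_right (s₁ := S) (s₂ := R))
  have h3 := hf.cutValue_eq htR hT
  have htSR : t ∉ S ∪ R := by simp [hS, htR]
  exact Finset.subset_union_left.trans (hmax _ htSR (hf.tight_of_le htSR (by omega)))

theorem Linked.succ {c' : V → ℕ} (hst : s ≠ t) (hik : i < k) (hf : G.IsFlow A f t u)
    {R : Finset V} (htR : t ∉ R)
    (hT : G.Tight A f t tok R) (hmax : ∀ S, t ∉ S → G.Tight A f t tok S → S ⊆ R)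
    (hL : G.Linked A f s t k i (fun y => u y + tok y)) (hc : ∀ y, y ≠ t → u y + tok y ≤ c' y)
    (hc' : ∀ e ∈ A, G.tail e ∈ R → G.head e ∉ R → G.head e ≠ t →
      u (G.head e) + tok (G.head e) + 1 ≤ c' (G.head e)) :
    G.Linked A f s t k (i + 1) c' := by
  intro Z e₀ he hs ht htl hh hR
  obtain h | ⟨β, hβ, hβZ, hβs, hcut⟩ := hL Z e₀ he hs ht htl hh hR
  · exact Or.inl h
  -- In this case `e₀` leaves the tight set `R` and must carry flow.
  by_cases hxR : G.tail e₀ ∈ R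
  · exact Or.inl (hT.1 e₀ he hxR (hh ▸ htR))
  right
  have hβc : ∀ y, β y ≤ c' y := by
    intro y
    by_cases hyt : y = t
    · by_contra h
      exact ht (hyt ▸ hβZ y (by omega))
    · exact (hβ y).trans (hc y hyt)
  -- Cuts of value at most `i + 1` are minimum for `β`, hence inside `R`; only these need to be
  -- raised.
  have hsub : ∀ S, t ∉ S → G.cutValue A β t S ≤ i + 1 → S ⊆ R := fun S hS hle =>
    hf.subset_of_minimum htR hT hmax hβ hS
      (hle.trans (hcut (S ∩ R) fun h => hS (Finset.mem_inter.1 h).1))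
  by_cases hsR : s ∈ R
  · obtain ⟨e, heA, h1, h2, h3⟩ := hR R hsR hxR
    have hbt : G.head e ≠ t := fun h => ht (h ▸ h2)
    -- The new unit goes where the path leaves `R`: in `Z`, and outside every small cut.
    refine ⟨fun y => β y + if y = G.head e then 1 else 0, ?_, ?_, ?_, ?_⟩
    · intro y
      have hy1 : β y ≤ u y + tok y := hβ y
      have hy2 := hβc y
      by_cases hy : y = G.head e
      · have := hc' e heA h1 h3 hbt
        subst hy
        dsimp only
        rw [if_pos rfl]
        omega
      · dsimp only
        rw [if_neg hy]
        omega
    · intro y hy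
      by_cases hy' : y = G.head e
      · exact hy' ▸ h2
      · exact hβZ y (by simpa [hy'] using hy)
    · dsimp only
      omega
    · intro S hS
      rw [cutValue_add]
      by_cases hle : G.cutValue A β t S ≤ i + 1
      · have hbS : G.head e ∉ S := fun h => h3 (hsub S hS hle h)
        have := Finset.single_le_sum
          (f := fun y => if y ∉ S ∧ y ≠ t then (if y = G.head e then 1 else 0) else 0)
          (fun _ _ => Nat.zero_le _) (Finset.mem_univ (G.head e))
        rw [if_pos ⟨hbS, hbt⟩, if_pos rfl] at this
        have := hcut S hS
        omega
      · omega
  -- If `s ∉ R`, a small cut would omit `s` and pay `β s ≥ k + 1 ≥ i + 2`, so there is none and `β`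
  -- needs no change.
  · refine ⟨β, hβc, hβZ, hβs, fun S hS => ?_⟩
    by_contra hlt
    have hsS : s ∉ S := fun h => hsR (hsub S hS (by omega) h)
    have := supply_le_cutValue (G := G) (A := A) (β := β) hsS hst
    omega

/-- After the last round the edges into `t` that carry no flow are superfluous. -/
theorem Linked.preserves [DecidableEq E] (hf : G.IsFlow A f t u)
    {R : Finset V} (htR : t ∉ R) (hT : G.Tight A f t tok R)
    (hL : G.Linked A f s t k k (fun y => u y + tok y)) {F : Finset E} (hF : F.card ≤ k)
    (hr : G.Reach (A \ F) s t) :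
    G.Reach ((A.filter fun e => G.head e = t → e ∈ f) \ F) s t := by
  classical
  set A' := A.filter fun e => G.head e = t → e ∈ f with hA'
  by_contra hno
  let Z : Finset V := Finset.univ.filter fun y => G.Reach (A' \ F) s y
  have hZ : ∀ y, y ∈ Z ↔ G.Reach (A' \ F) s y := fun y => by simp [Z]
  have htZ : t ∉ Z := fun h => hno ((hZ t).1 h)
  have hstep : ∀ e ∈ A, e ∉ F → G.tail e ∈ Z → G.head e ≠ t → G.head e ∈ Z := by
    intro e he heF h1 h2
    rw [hZ] at h1 ⊢
    exact h1.tail ⟨e, Finset.mem_sdiff.2 ⟨Finset.mem_filter.2 ⟨he, fun h => absurd h h2⟩, heF⟩,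
      rfl, rfl⟩
  have hsZ : s ∈ Z := (hZ s).2 Relation.ReflTransGen.refl
  -- Only edges into `t` were deleted, so a path of `A - F` can leave `Z` only by entering `t`.
  obtain ⟨e₀, he₀, he₀F, htl, hh⟩ : ∃ e ∈ A, e ∉ F ∧ G.tail e ∈ Z ∧ G.head e = t := by
    by_contra hcon
    push Not at hcon
    have : ∀ w, G.Reach (A \ F) s w → w ∈ Z := by
      intro w hw
      induction hw with
      | refl => exact hsZ
      | tail _ hxy ih =>
        obtain ⟨e, he, h1, h2⟩ := hxy
        rw [Finset.mem_sdiff] at he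
        subst h1 h2
        exact hstep e he.1 he.2 ih (hcon e he.1 he.2 ih)
    exact htZ (this t hr)
  have hexit : ∀ R : Finset V, s ∈ R → G.tail e₀ ∉ R →
      ∃ e ∈ A, G.tail e ∈ R ∧ G.head e ∈ Z ∧ G.head e ∉ R := by
    intro R hsR hxR
    by_contra hcon
    push Not at hcon
    have : ∀ w, G.Reach (A' \ F) s w → w ∈ R := by
      intro w hw
      induction hw with
      | refl => exact hsR
      | tail hx hxy ih =>
        obtain ⟨e, he, h1, h2⟩ := hxy
        have heA := (Finset.mem_filter.1 (Finset.mem_sdiff.1 he).1).1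
        subst h1 h2
        exact hcon e heA ih ((hZ _).2 (hx.tail ⟨e, he, rfl, rfl⟩))
    exact hxR (this _ ((hZ _).1 htl))
  have hA'A : A' ⊆ A := Finset.filter_subset _ _
  have hf' : G.IsFlow A' f t u :=
    ⟨fun e he => Finset.mem_filter.2 ⟨hf.sub he, fun _ => he⟩, hf.cons, hf.noOut⟩
  obtain h | ⟨β, hβ, hβZ, -, hcut⟩ := hL Z e₀ he₀ hsZ htZ htl hh hexit
  · exact hno (((hZ _).1 htl).tail
      ⟨e₀, Finset.mem_sdiff.2 ⟨Finset.mem_filter.2 ⟨he₀, fun _ => h⟩, he₀F⟩, rfl, hh⟩)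
  -- An edge from a subset of `R` to `t` leaves `R`, carries flow and is kept.
  have hsame : ∀ S ⊆ R, G.cutValue A' β t S = G.cutValue A β t S := by
    intro S hS
    unfold cutValue
    congr 1
    refine Finset.sum_subset hA'A fun e he hne => if_neg fun h => hne ?_
    refine Finset.mem_filter.2 ⟨he, fun hh' => hT.1 e he (hS h.1) (hh' ▸ htR)⟩
  have hT' : G.Tight A' f t tok R := ⟨fun e he => hT.1 e (hA'A he), hT.2⟩
  have htZR : t ∉ Z ∪ R := by simp [htZ, htR]
  have h1 := cutValue_submodular (G := G) (A := A') (c := β) (t := t) Z R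
  have h2 := cutValue_antitone_defect (G := G) (A := A') (c := fun y => u y + tok y) (t := t) hβ
    (Finset.subset_union_right (s₁ := Z) (s₂ := R))
  have h3 := hf'.cutValue_eq htR hT'
  have h4 := hf'.le_cutValue htZR tok
  have h5 := hsame (Z ∩ R) Finset.inter_subset_right
  have h6 := hcut (Z ∩ R) fun h => htZ (Finset.mem_inter.1 h).1
  -- All of `β` lies in `Z`, and an edge of `A'` that leaves `Z` is a fault.
  have h7 : G.cutValue A' β t Z ≤ F.card := by
    have h8 : (∑ y, if y ∉ Z ∧ y ≠ t then β y else 0) = 0 :=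
      Finset.sum_eq_zero fun y _ => by
        split_ifs with h
        · by_contra hne
          exact h.1 (hβZ y hne)
        · rfl
    unfold cutValue
    rw [h8, add_zero, ← Finset.card_filter]
    refine Finset.card_le_card fun e he => ?_
    obtain ⟨heA, h1, h2⟩ := Finset.mem_filter.1 he
    by_contra heF
    exact h2 ((hZ _).2 (((hZ _).1 h1).tail ⟨e, Finset.mem_sdiff.2 ⟨heA, heF⟩, rfl, rfl⟩))
  -- `Z` has value at most `k` and `Z ∩ R` at least `k + 1`, so by `h1` the set `Z ∪ R` is cheaper
  -- than `R` for `β`, and by `h2` for the full supplies. But `f` is still a flow in `A'`, and its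
  -- value is that of the cut `R`.
  omega

end Flow

end MDigraph

namespace RAM

/-! ## A language with named registers and arrays -/

/-- Named registers. -/
inductive Reg : Type where
  | n | m | k | s | one | zero | m2 | k1 | a | a2 | d | d2 | v | w | x | z | p | t | i | qh | qt | fnd
  deriving DecidableEq

/-- Named arrays; `io` is the part of the memory that holds the input and the output. -/
inductive Arr : Type where
  | io | org | mate | next | res | first | vis | par | tok | queue | alive
  deriving DecidableEq

/-- Programs over named registers and arrays. -/
inductive Cmd : Type where
  | skip : Cmd
  | const (x : Reg) (c : ℕ) : Cmd
  | add (x y z : Reg) : Cmd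
  | sub (x y z : Reg) : Cmd
  | get (x : Reg) (a : Arr) (y : Reg) : Cmd
  | put (a : Arr) (x y : Reg) : Cmd
  | seq (p q : Cmd) : Cmd
  | ite (x y : Reg) (p q : Cmd) : Cmd
  | while (x y : Reg) (p : Cmd) : Cmd

infixr:60 " ;; " => Cmd.seq

/-- Contents of the named registers and arrays. -/
structure Store where
  reg : Reg → ℕ
  arr : Arr → ℕ → ℕ

namespace Store

def setReg (σ : Store) (x : Reg) (b : ℕ) : Store := ⟨Function.update σ.reg x b, σ.arr⟩

def setArr (σ : Store) (a : Arr) (i b : ℕ) : Store :=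
  ⟨σ.reg, Function.update σ.arr a (Function.update (σ.arr a) i b)⟩

@[simp] theorem setReg_reg (σ : Store) (x y : Reg) (b : ℕ) :
    (σ.setReg x b).reg y = if y = x then b else σ.reg y := by
  simp [setReg, Function.update_apply]

@[simp] theorem setReg_arr (σ : Store) (x : Reg) (b : ℕ) : (σ.setReg x b).arr = σ.arr := rfl

@[simp] theorem setArr_reg (σ : Store) (a : Arr) (i b : ℕ) : (σ.setArr a i b).reg = σ.reg := rfl

@[simp] theorem setArr_arr (σ : Store) (a c : Arr) (i b : ℕ) :
    (σ.setArr a i b).arr c = if c = a then Function.update (σ.arr a) i b else σ.arr c := by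
  simp only [setArr, Function.update_apply]

end Store

/-- Execution where all numbers are at most `B` and the array `io` has length `M`. -/
inductive CExec (B M : ℕ) : Cmd → Store → Store → ℕ → Prop where
  | skip (σ : Store) : CExec B M .skip σ σ 1
  | const (σ : Store) (x : Reg) (c : ℕ) : c ≤ B → CExec B M (.const x c) σ (σ.setReg x c) 1
  | add (σ : Store) (x y z : Reg) : σ.reg y + σ.reg z ≤ B →
      CExec B M (.add x y z) σ (σ.setReg x (σ.reg y + σ.reg z)) 1
  | sub (σ : Store) (x y z : Reg) :
      CExec B M (.sub x y z) σ (σ.setReg x (σ.reg y - σ.reg z)) 1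
  | get (σ : Store) (x : Reg) (a : Arr) (y : Reg) : (a = Arr.io → σ.reg y < M) →
      CExec B M (.get x a y) σ (σ.setReg x (σ.arr a (σ.reg y))) 1
  | put (σ : Store) (a : Arr) (x y : Reg) : (a = Arr.io → σ.reg x < M) →
      CExec B M (.put a x y) σ (σ.setArr a (σ.reg x) (σ.reg y)) 1
  | seq {p q : Cmd} {σ σ' τ : Store} {t₁ t₂ : ℕ} :
      CExec B M p σ σ' t₁ → CExec B M q σ' τ t₂ → CExec B M (.seq p q) σ τ (t₁ + t₂)
  | ite_true {p q : Cmd} {x y : Reg} {σ τ : Store} {t : ℕ} : σ.reg x < σ.reg y →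
      CExec B M p σ τ t → CExec B M (.ite x y p q) σ τ (t + 1)
  | ite_false {p q : Cmd} {x y : Reg} {σ τ : Store} {t : ℕ} : ¬ σ.reg x < σ.reg y →
      CExec B M q σ τ t → CExec B M (.ite x y p q) σ τ (t + 1)
  | while_true {p : Cmd} {x y : Reg} {σ σ' τ : Store} {t₁ t₂ : ℕ} : σ.reg x < σ.reg y →
      CExec B M p σ σ' t₁ → CExec B M (.while x y p) σ' τ t₂ →
      CExec B M (.while x y p) σ τ (t₁ + t₂ + 1)
  | while_false {p : Cmd} {x y : Reg} {σ : Store} : ¬ σ.reg x < σ.reg y →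
      CExec B M (.while x y p) σ σ 1

/-! ### Compilation -/

def Reg.code (r : Reg) : ℕ := r.ctorIdx

def Arr.code (a : Arr) : ℕ := a.ctorIdx

theorem Reg.code_inj {r r' : Reg} : r.code = r'.code ↔ r = r' := by
  constructor
  · intro h
    cases r <;> cases r' <;> first | rfl | exact absurd h (by decide)
  · rintro rfl; rfl

theorem Arr.code_inj {a b : Arr} : a.code = b.code ↔ a = b := by
  constructor
  · intro h
    cases a <;> cases b <;> first | rfl | exact absurd h (by decide)
  · rintro rfl; rfl

/-- This leaves machine register `40` for the base address and `41`, `42` for address arithmetic. -/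
theorem Reg.code_lt (r : Reg) : r.code < 40 := by cases r <;> decide

/-- Behind the `M` cells of `io` the other arrays are interleaved with stride `16`, so each of them
is unbounded. -/
theorem Arr.code_lt (a : Arr) : a.code < 16 := by cases a <;> decide

/-- Put the address of cell `y` of the array `a` into machine register `41`. -/
def addrCode (a : Arr) (y : ℕ) : Prog :=
  .seq (.add 41 y y) <| .seq (.add 41 41 41) <| .seq (.add 41 41 41) <| .seq (.add 41 41 41) <|
    .seq (.const 42 a.code) <| .seq (.add 41 41 42) (.add 41 41 40)

def Cmd.compile : Cmd → Prog
  | .skip => .skip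
  | .const x c => .const x.code c
  | .add x y z => .add x.code y.code z.code
  | .sub x y z => .sub x.code y.code z.code
  | .get x a y =>
    if a = Arr.io then .load x.code y.code else .seq (addrCode a y.code) (.load x.code 41)
  | .put a x y =>
    if a = Arr.io then .store x.code y.code else .seq (addrCode a x.code) (.store 41 y.code)
  | .seq p q => .seq p.compile q.compile
  | .ite x y p q => .ite x.code y.code p.compile q.compile
  | .while x y p => .while x.code y.code p.compile

/-- The machine state `μ` represents the store `σ`. -/
structure Sim (B M : ℕ) (μ : State) (σ : Store) : Prop where
  reg : ∀ r : Reg, μ.reg r.code = σ.reg r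
  base : μ.reg 40 = M
  io : ∀ i < M, μ.mem i = σ.arr Arr.io i
  arr : ∀ a, a ≠ Arr.io → ∀ i, μ.mem (M + 16 * i + a.code) = σ.arr a i
  reg_le : ∀ r, σ.reg r ≤ B
  arr_le : ∀ a i, σ.arr a i ≤ B

theorem Sim.setReg {B M : ℕ} {μ : State} {σ : Store} (h : Sim B M μ σ) (x : Reg) {b : ℕ}
    (hb : b ≤ B) : Sim B M (μ.setReg x.code b) (σ.setReg x b) where
  reg r := by
    have := h.reg r
    by_cases hr : r = x
    · simp [State.setReg, hr]
    · have hc : r.code ≠ x.code := fun h' => hr (Reg.code_inj.1 h')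
      simp [State.setReg, hr, hc, this]
  base := by
    have := x.code_lt
    have hne : (40 : ℕ) ≠ x.code := by omega
    simp [State.setReg, hne, h.base]
  io := h.io
  arr := h.arr
  reg_le r := by
    rw [Store.setReg_reg]
    split_ifs
    · exact hb
    · exact h.reg_le r
  arr_le := h.arr_le

theorem Sim.setTemp {B M : ℕ} {μ : State} {σ : Store} (h : Sim B M μ σ) {x : ℕ}
    (hx : 40 < x) (b : ℕ) : Sim B M (μ.setReg x b) σ where
  reg r := by
    have := r.code_lt
    have hne : r.code ≠ x := by omega
    simp [State.setReg, hne, h.reg]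
  base := by
    have hne : (40 : ℕ) ≠ x := by omega
    simp [State.setReg, hne, h.base]
  io := h.io
  arr := h.arr
  reg_le := h.reg_le
  arr_le := h.arr_le

/-- The address of a cell of an array. -/
def addr (M : ℕ) (a : Arr) (i : ℕ) : ℕ := if a = Arr.io then i else M + 16 * i + a.code

theorem Sim.setArr {B M : ℕ} {μ : State} {σ : Store} (h : Sim B M μ σ) (a : Arr) (i : ℕ)
    {b : ℕ} (hi : a = Arr.io → i < M) (hb : b ≤ B) :
    Sim B M (μ.setMem (addr M a i) b) (σ.setArr a i b) where
  reg := h.reg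
  base := h.base
  io j hj := by
    by_cases ha : a = Arr.io
    · subst ha
      have := h.io j hj
      simp [State.setMem, addr, Function.update_apply, this]
    · have hne : j ≠ M + 16 * i + a.code := by omega
      have ha' : Arr.io ≠ a := Ne.symm ha
      simp [State.setMem, addr, ha, ha', hne, h.io j hj]
  arr c hc j := by
    have hcl := c.code_lt
    have hal := a.code_lt
    by_cases ha : a = Arr.io
    · have hne : M + 16 * j + c.code ≠ i := by have := hi ha; omega
      have hca : c ≠ a := fun h' => hc (h'.trans ha)
      simp only [State.setMem, addr, ha, if_true, Function.update_of_ne hne, Store.setArr_arr, hc,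
        if_false]
      exact h.arr c hc j
    · by_cases hca : c = a
      · subst hca
        have := h.arr c hc j
        by_cases hij : j = i
        · simp [State.setMem, addr, ha, hij]
        · have hne : M + 16 * j + c.code ≠ M + 16 * i + c.code := by omega
          simp only [State.setMem, addr, ha, if_false, Function.update_of_ne hne,
            Store.setArr_arr, if_true, Function.update_of_ne hij]
          exact this
      · have hne : M + 16 * j + c.code ≠ M + 16 * i + a.code := by
          have : c.code ≠ a.code := fun h' => hca (Arr.code_inj.1 h')
          omega
        simp only [State.setMem, addr, ha, if_false, Function.update_of_ne hne, Store.setArr_arr,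
          hca]
        exact h.arr c hc j
  reg_le := h.reg_le
  arr_le c j := by
    rw [Store.setArr_arr]
    split_ifs
    · rw [Function.update_apply]
      split_ifs
      · exact hb
      · exact h.arr_le a j
    · exact h.arr_le c j

theorem exec_addrCode {W B M : ℕ} (hW : M + 16 * B + 16 < W) {μ : State} {σ : Store}
    (h : Sim B M μ σ) (a : Arr) (y : Reg) :
    ∃ μ', Exec W (addrCode a y.code) μ μ' 7 ∧ Sim B M μ' σ ∧
      μ'.reg 41 = M + 16 * σ.reg y + a.code := by
  have hy := h.reg y
  have hyB := h.reg_le y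
  have hac := a.code_lt
  have hb := h.base
  set b := σ.reg y with hbdef
  let μ₁ := μ.setReg 41 (b + b)
  let μ₂ := μ₁.setReg 41 ((b + b) + (b + b))
  let μ₃ := μ₂.setReg 41 (((b + b) + (b + b)) + ((b + b) + (b + b)))
  let μ₄ := μ₃.setReg 41 ((((b + b) + (b + b)) + ((b + b) + (b + b))) +
    (((b + b) + (b + b)) + ((b + b) + (b + b))))
  let μ₅ := μ₄.setReg 42 a.code
  let μ₆ := μ₅.setReg 41 (((((b + b) + (b + b)) + ((b + b) + (b + b))) +
    (((b + b) + (b + b)) + ((b + b) + (b + b)))) + a.code)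
  let μ₇ := μ₆.setReg 41 ((((((b + b) + (b + b)) + ((b + b) + (b + b))) +
    (((b + b) + (b + b)) + ((b + b) + (b + b)))) + a.code) + M)
  have e₁ : Exec W (.add 41 y.code y.code) μ μ₁ 1 := by
    have := Exec.add (W := W) μ 41 y.code y.code (by rw [hy]; omega)
    rwa [hy] at this
  have step : ∀ (μ : State) (b : ℕ), μ.reg 41 = b → b + b < W →
      Exec W (.add 41 41 41) μ (μ.setReg 41 (b + b)) 1 := by
    rintro μ b rfl hlt
    exact Exec.add μ 41 41 41 hlt
  have e₂ : Exec W (.add 41 41 41) μ₁ μ₂ 1 := step _ _ (by simp [μ₁, State.setReg]) (by omega)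
  have e₃ : Exec W (.add 41 41 41) μ₂ μ₃ 1 := step _ _ (by simp [μ₂, State.setReg]) (by omega)
  have e₄ : Exec W (.add 41 41 41) μ₃ μ₄ 1 := step _ _ (by simp [μ₃, State.setReg]) (by omega)
  have e₅ : Exec W (.const 42 a.code) μ₄ μ₅ 1 := Exec.const _ _ _ (by omega)
  have step' : ∀ (μ : State) (b c z : ℕ), μ.reg 41 = b → μ.reg z = c → b + c < W →
      Exec W (.add 41 41 z) μ (μ.setReg 41 (b + c)) 1 := by
    rintro μ b c z rfl rfl hlt
    exact Exec.add μ 41 41 z hlt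
  have e₆ : Exec W (.add 41 41 42) μ₅ μ₆ 1 :=
    step' _ _ _ _ (by simp [μ₅, μ₄, State.setReg]) (by simp [μ₅, State.setReg]) (by omega)
  have e₇ : Exec W (.add 41 41 40) μ₆ μ₇ 1 :=
    step' _ _ _ _ (by simp [μ₆, State.setReg])
      (by simp [μ₆, μ₅, μ₄, μ₃, μ₂, μ₁, State.setReg, hb]) (by omega)
  refine ⟨μ₇, e₁.seq (e₂.seq (e₃.seq (e₄.seq (e₅.seq (e₆.seq e₇))))), ?_, ?_⟩
  · exact ((((((h.setTemp (by omega) _).setTemp (by omega) _).setTemp (by omega) _).setTemp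
      (by omega) _).setTemp (by omega) _).setTemp (by omega) _).setTemp (by omega) _
  · simp only [μ₇, State.setReg, Function.update_self]
    omega

/-- The factor `8` is an array access: seven steps for the address, one for the access. -/
theorem CExec.compile {W B M : ℕ} (hW : M + 16 * B + 16 < W) {p : Cmd} {σ τ : Store} {t : ℕ}
    (h : CExec B M p σ τ t) : ∀ μ : State, Sim B M μ σ →
      ∃ (ν : State) (t' : ℕ), Exec W p.compile μ ν t' ∧ Sim B M ν τ ∧ t' ≤ 8 * t := by
  induction h with
  | skip σ => exact fun μ hμ => ⟨μ, 1, Exec.skip μ, hμ, by omega⟩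
  | const σ x c hc =>
    exact fun μ hμ => ⟨_, 1, Exec.const μ _ _ (by omega), hμ.setReg x hc, by omega⟩
  | add σ x y z hc =>
    intro μ hμ
    refine ⟨_, 1, Exec.add μ _ _ _ (by rw [hμ.reg, hμ.reg]; omega), ?_, by omega⟩
    rw [hμ.reg, hμ.reg]
    exact hμ.setReg x hc
  | sub σ x y z =>
    intro μ hμ
    refine ⟨_, 1, Exec.sub μ _ _ _, ?_, by omega⟩
    rw [hμ.reg, hμ.reg]
    exact hμ.setReg x ((Nat.sub_le _ _).trans (hμ.reg_le y))
  | get σ x a y hM =>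
    intro μ hμ
    by_cases ha : a = Arr.io
    · refine ⟨_, 1, by rw [Cmd.compile, if_pos ha]; exact Exec.load μ _ _, ?_, by omega⟩
      rw [hμ.reg, hμ.io _ (hM ha), ← ha]
      exact hμ.setReg x (hμ.arr_le _ _)
    · obtain ⟨μ', he, hs, hr⟩ := exec_addrCode hW hμ a y
      refine ⟨_, 7 + 1, by rw [Cmd.compile, if_neg ha]; exact he.seq (Exec.load μ' _ _), ?_,
        by omega⟩
      rw [hr, hs.arr a ha]
      exact hs.setReg x (hμ.arr_le _ _)
  | put σ a x y hM =>
    intro μ hμ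
    by_cases ha : a = Arr.io
    · refine ⟨_, 1, by rw [Cmd.compile, if_pos ha]; exact Exec.store μ _ _, ?_, by omega⟩
      have := hμ.setArr a (σ.reg x) hM (hμ.reg_le y)
      rw [addr, if_pos ha] at this
      rw [hμ.reg, hμ.reg]
      exact this
    · obtain ⟨μ', he, hs, hr⟩ := exec_addrCode hW hμ a x
      refine ⟨_, 7 + 1, by rw [Cmd.compile, if_neg ha]; exact he.seq (Exec.store μ' _ _), ?_,
        by omega⟩
      have := hs.setArr a (σ.reg x) hM (hμ.reg_le y)
      rw [addr, if_neg ha] at this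
      rw [hr, hs.reg]
      exact this
  | seq _ _ ih₁ ih₂ =>
    intro μ hμ
    obtain ⟨ν, t₁, h₁, hs, hle⟩ := ih₁ μ hμ
    obtain ⟨ν', t₂, h₂, hs', hle'⟩ := ih₂ ν hs
    exact ⟨ν', _, h₁.seq h₂, hs', by omega⟩
  | ite_true hlt _ ih =>
    intro μ hμ
    obtain ⟨ν, t₁, h₁, hs, hle⟩ := ih μ hμ
    exact ⟨ν, _, Exec.ite_true (by rwa [hμ.reg, hμ.reg]) h₁, hs, by omega⟩
  | ite_false hlt _ ih =>
    intro μ hμ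
    obtain ⟨ν, t₁, h₁, hs, hle⟩ := ih μ hμ
    exact ⟨ν, _, Exec.ite_false (by rwa [hμ.reg, hμ.reg]) h₁, hs, by omega⟩
  | while_true hlt _ _ ih₁ ih₂ =>
    intro μ hμ
    obtain ⟨ν, t₁, h₁, hs, hle⟩ := ih₁ μ hμ
    obtain ⟨ν', t₂, h₂, hs', hle'⟩ := ih₂ ν hs
    exact ⟨ν', _, Exec.while_true (by rwa [hμ.reg, hμ.reg]) h₁ h₂, hs', by omega⟩
  | while_false hlt =>
    intro μ hμ
    exact ⟨μ, 1, Exec.while_false (by rwa [hμ.reg, hμ.reg]), hμ, by omega⟩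

/-! ### Total correctness with time -/

/-- From `σ` the program `p` halts after some number `t` of steps in a store `τ` with `Q τ t`. -/
def WP (B M : ℕ) (p : Cmd) (σ : Store) (Q : Store → ℕ → Prop) : Prop :=
  ∃ τ t, CExec B M p σ τ t ∧ Q τ t

section WP

variable {B M : ℕ} {p q : Cmd} {σ : Store} {P Q : Store → ℕ → Prop} {x y z : Reg} {a : Arr}

theorem WP.imp (h : WP B M p σ P) (hPQ : ∀ τ t, P τ t → Q τ t) : WP B M p σ Q :=
  let ⟨τ, t, he, hP⟩ := h
  ⟨τ, t, he, hPQ τ t hP⟩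

theorem wp_skip : WP B M .skip σ Q ↔ Q σ 1 :=
  ⟨fun ⟨_, _, he, hQ⟩ => by cases he; exact hQ, fun h => ⟨_, _, .skip σ, h⟩⟩

theorem wp_const {c : ℕ} : WP B M (.const x c) σ Q ↔ c ≤ B ∧ Q (σ.setReg x c) 1 :=
  ⟨fun ⟨_, _, he, hQ⟩ => by cases he with | const _ _ _ h => exact ⟨h, hQ⟩,
    fun h => ⟨_, _, .const σ x c h.1, h.2⟩⟩

theorem wp_add : WP B M (.add x y z) σ Q ↔
    σ.reg y + σ.reg z ≤ B ∧ Q (σ.setReg x (σ.reg y + σ.reg z)) 1 :=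
  ⟨fun ⟨_, _, he, hQ⟩ => by cases he with | add _ _ _ _ h => exact ⟨h, hQ⟩,
    fun h => ⟨_, _, .add σ x y z h.1, h.2⟩⟩

theorem wp_sub : WP B M (.sub x y z) σ Q ↔ Q (σ.setReg x (σ.reg y - σ.reg z)) 1 :=
  ⟨fun ⟨_, _, he, hQ⟩ => by cases he; exact hQ, fun h => ⟨_, _, .sub σ x y z, h⟩⟩

theorem wp_get : WP B M (.get x a y) σ Q ↔
    (a = Arr.io → σ.reg y < M) ∧ Q (σ.setReg x (σ.arr a (σ.reg y))) 1 :=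
  ⟨fun ⟨_, _, he, hQ⟩ => by cases he with | get _ _ _ _ h => exact ⟨h, hQ⟩,
    fun h => ⟨_, _, .get σ x a y h.1, h.2⟩⟩

theorem wp_put : WP B M (.put a x y) σ Q ↔
    (a = Arr.io → σ.reg x < M) ∧ Q (σ.setArr a (σ.reg x) (σ.reg y)) 1 :=
  ⟨fun ⟨_, _, he, hQ⟩ => by cases he with | put _ _ _ _ h => exact ⟨h, hQ⟩,
    fun h => ⟨_, _, .put σ a x y h.1, h.2⟩⟩

theorem wp_seq : WP B M (.seq p q) σ Q ↔
    WP B M p σ fun τ t => WP B M q τ fun τ' t' => Q τ' (t + t') :=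
  ⟨fun ⟨_, _, he, hQ⟩ => by
      cases he with | seq h₁ h₂ => exact ⟨_, _, h₁, _, _, h₂, hQ⟩,
    fun ⟨_, _, h₁, _, _, h₂, hQ⟩ => ⟨_, _, .seq h₁ h₂, hQ⟩⟩

theorem WP.seq (h : WP B M p σ P) (h' : ∀ τ t, P τ t → WP B M q τ fun τ' t' => Q τ' (t + t')) :
    WP B M (.seq p q) σ Q :=
  wp_seq.2 (h.imp h')

theorem wp_ite : WP B M (.ite x y p q) σ Q ↔
    (σ.reg x < σ.reg y → WP B M p σ fun τ t => Q τ (t + 1)) ∧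
      (¬ σ.reg x < σ.reg y → WP B M q σ fun τ t => Q τ (t + 1)) := by
  constructor
  · rintro ⟨_, _, he, hQ⟩
    cases he with
    | ite_true h he => exact ⟨fun _ => ⟨_, _, he, hQ⟩, fun h' => absurd h h'⟩
    | ite_false h he => exact ⟨fun h' => absurd h' h, fun _ => ⟨_, _, he, hQ⟩⟩
  · intro h
    by_cases hlt : σ.reg x < σ.reg y
    · obtain ⟨_, _, he, hQ⟩ := h.1 hlt
      exact ⟨_, _, .ite_true hlt he, hQ⟩
    · obtain ⟨_, _, he, hQ⟩ := h.2 hlt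
      exact ⟨_, _, .ite_false hlt he, hQ⟩

/-- The rule for loops. `I N σ` is the invariant, where `N` is a bound for the time that is left
for the remaining iterations. -/
theorem wp_while (I : ℕ → Store → Prop)
    (hbody : ∀ N σ, I N σ → σ.reg x < σ.reg y →
      WP B M p σ fun τ t => ∃ N', I N' τ ∧ t + 1 + N' ≤ N) :
    ∀ N σ, I N σ → WP B M (.while x y p) σ fun τ t =>
      ∃ N', I N' τ ∧ ¬ τ.reg x < τ.reg y ∧ t + N' ≤ N + 1 := by
  intro N
  induction N using Nat.strong_induction_on with
  | _ N ih =>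
    intro σ hI
    by_cases hlt : σ.reg x < σ.reg y
    · obtain ⟨τ, t, he, N', hI', hN⟩ := hbody N σ hI hlt
      obtain ⟨τ', t', he', N'', hI'', hn, hN'⟩ := ih N' (by omega) τ hI'
      exact ⟨τ', _, .while_true hlt he he', N'', hI'', hn, by omega⟩
    · exact ⟨σ, 1, .while_false hlt, N, hI, hlt, by omega⟩

end WP

/-! ### Frames -/

/-- The program `p` does not write to the register `r`. -/
def Cmd.keepsReg : Cmd → Reg → Bool
  | .skip, _ => true
  | .const x _, r => r ≠ x
  | .add x _ _, r => r ≠ x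
  | .sub x _ _, r => r ≠ x
  | .get x _ _, r => r ≠ x
  | .put _ _ _, _ => true
  | .seq p q, r => p.keepsReg r && q.keepsReg r
  | .ite _ _ p q, r => p.keepsReg r && q.keepsReg r
  | .while _ _ p, r => p.keepsReg r

/-- The program `p` does not write to the array `b`. -/
def Cmd.keepsArr : Cmd → Arr → Bool
  | .skip, _ => true
  | .const _ _, _ => true
  | .add _ _ _, _ => true
  | .sub _ _ _, _ => true
  | .get _ _ _, _ => true
  | .put a _ _, b => b ≠ a
  | .seq p q, b => p.keepsArr b && q.keepsArr b
  | .ite _ _ p q, b => p.keepsArr b && q.keepsArr b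
  | .while _ _ p, b => p.keepsArr b

theorem CExec.reg_eq {B M : ℕ} {p : Cmd} {σ τ : Store} {t : ℕ} (h : CExec B M p σ τ t) {r : Reg} :
    p.keepsReg r = true → τ.reg r = σ.reg r := by
  induction h <;> simp_all [Cmd.keepsReg]

theorem CExec.arr_eq {B M : ℕ} {p : Cmd} {σ τ : Store} {t : ℕ} (h : CExec B M p σ τ t) {b : Arr} :
    p.keepsArr b = true → τ.arr b = σ.arr b := by
  induction h <;> simp_all [Cmd.keepsArr]

/-- The store `τ` agrees with `σ` on all registers and arrays that `p` does not write to. -/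
def Frame (p : Cmd) (σ τ : Store) : Prop :=
  (∀ r, p.keepsReg r = true → τ.reg r = σ.reg r) ∧ ∀ b, p.keepsArr b = true → τ.arr b = σ.arr b

/-- Specifications need to mention only what a program changes; the rest is read off its syntax by
`decide`. -/
theorem WP.frame {B M : ℕ} {p : Cmd} {σ : Store} {Q : Store → ℕ → Prop} (h : WP B M p σ Q) :
    WP B M p σ fun τ t => Q τ t ∧ Frame p σ τ :=
  let ⟨τ, t, he, hQ⟩ := h
  ⟨τ, t, he, hQ, fun _ => he.reg_eq, fun _ => he.arr_eq⟩

/-! ### Counting loops -/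

/-- Run `p` with `d = 0, 2, 4, …` as long as `d < m2`, and with `d2 = d + 1`. -/
def forEdges (d d2 : Reg) (p : Cmd) : Cmd :=
  .const d 0 ;; .while d .m2 (.add d2 d .one ;; p ;; .add d d2 .one)

/-- The `3` per iteration pays for the test and two additions. By `hI` the invariant does not see
the counters. -/
theorem wp_forEdges {B M m c : ℕ} {d d2 : Reg} {p : Cmd} (I : ℕ → Store → Prop)
    (hd2 : d ≠ d2) (hm2 : d ≠ .m2 ∧ d2 ≠ .m2) (hone : d ≠ .one ∧ d2 ≠ .one)
    (hp : p.keepsReg d = true ∧ p.keepsReg d2 = true ∧ p.keepsReg .m2 = true ∧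
      p.keepsReg .one = true) (hB : 2 * m ≤ B)
    (hI : ∀ e σ b, I e σ → I e (σ.setReg d b) ∧ I e (σ.setReg d2 b))
    (hbody : ∀ e < m, ∀ σ, I e σ → σ.reg d = 2 * e → σ.reg d2 = 2 * e + 1 →
      σ.reg .m2 = 2 * m → σ.reg .one = 1 → WP B M p σ fun τ t => I (e + 1) τ ∧ t ≤ c)
    {σ : Store} (h0 : I 0 σ) (hσ2 : σ.reg .m2 = 2 * m) (hσ1 : σ.reg .one = 1) :
    WP B M (forEdges d d2 p) σ fun τ t => I m τ ∧ t ≤ (c + 3) * m + 2 := by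
  refine wp_seq.2 (wp_const.2 ⟨Nat.zero_le _, ?_⟩)
  refine (wp_while (fun N σ => ∃ e ≤ m, I e σ ∧ σ.reg d = 2 * e ∧ σ.reg .m2 = 2 * m ∧
    σ.reg .one = 1 ∧ N = (c + 3) * (m - e)) ?_ ((c + 3) * m) _ ?_).imp ?_
  · rintro N σ ⟨e, hem, hIe, hd, hm, h1, rfl⟩ hlt
    have hem' : e < m := by omega
    rw [wp_seq, wp_add]
    refine ⟨by omega, ?_⟩
    have hb := hbody e hem' (σ.setReg d2 (σ.reg d + σ.reg .one)) (hI _ _ _ hIe).2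
      (by simp [hd2, hd]) (by simp [hd, h1]) (by simp [hm2.2.symm, hm]) (by simp [hone.2.symm, h1])
    refine WP.seq hb.frame ?_
    rintro τ t ⟨⟨hIτ, ht⟩, hfr, -⟩
    have f1 := hfr _ hp.1
    have f2 := hfr _ hp.2.1
    have f3 := hfr _ hp.2.2.1
    have f4 := hfr _ hp.2.2.2
    simp [hd2, hm2.2.symm, hone.2.symm, hd, h1, hm] at f1 f2 f3 f4
    rw [wp_add]
    refine ⟨by omega, (c + 3) * (m - (e + 1)), ⟨e + 1, by omega, (hI _ _ _ hIτ).1, ?_, ?_, ?_,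
      rfl⟩, ?_⟩
    · simp only [Store.setReg_reg, if_true, f2, f4]
      ring
    · simp [hm2.1.symm, f3]
    · simp [hone.1.symm, f4]
    · have : m - e = m - (e + 1) + 1 := by omega
      rw [this, Nat.mul_add]
      omega
  · refine ⟨0, Nat.zero_le _, (hI _ _ _ h0).1, by simp, by simp [hm2.1.symm, hσ2],
      by simp [hone.1.symm, hσ1], by simp⟩
  · rintro τ t ⟨N', ⟨e, hem, hIe, hd, hm, -, rfl⟩, hn, ht⟩
    have : e = m := by omega
    subst this
    refine ⟨hIe, ?_⟩
    omega

/-- Run `p` with `v = 0, 1, 2, …` as long as `v < n`. -/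
def forVerts (p : Cmd) : Cmd :=
  .const .v 0 ;; .while .v .n (p ;; .add .v .v .one)

theorem wp_forVerts {B M n c : ℕ} {p : Cmd} (I : ℕ → Store → Prop)
    (hp : p.keepsReg .v = true ∧ p.keepsReg .n = true ∧ p.keepsReg .one = true) (hB : n ≤ B)
    (hI : ∀ e σ b, I e σ → I e (σ.setReg .v b))
    (hbody : ∀ e < n, ∀ σ, I e σ → σ.reg .v = e → σ.reg .n = n → σ.reg .one = 1 →
      WP B M p σ fun τ t => I (e + 1) τ ∧ t ≤ c)
    {σ : Store} (h0 : I 0 σ) (hσ2 : σ.reg .n = n) (hσ1 : σ.reg .one = 1) :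
    WP B M (forVerts p) σ fun τ t => I n τ ∧ t ≤ (c + 2) * n + 2 := by
  refine wp_seq.2 (wp_const.2 ⟨Nat.zero_le _, ?_⟩)
  refine (wp_while (fun N σ => ∃ e ≤ n, I e σ ∧ σ.reg .v = e ∧ σ.reg .n = n ∧
    σ.reg .one = 1 ∧ N = (c + 2) * (n - e)) ?_ ((c + 2) * n) _ ?_).imp ?_
  · rintro N σ ⟨e, hem, hIe, hd, hm, h1, rfl⟩ hlt
    have hem' : e < n := by omega
    refine WP.seq (hbody e hem' σ hIe hd hm h1).frame ?_
    rintro τ t ⟨⟨hIτ, ht⟩, hfr, -⟩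
    have f1 := hfr _ hp.1
    have f3 := hfr _ hp.2.1
    have f4 := hfr _ hp.2.2
    rw [wp_add]
    refine ⟨by omega, (c + 2) * (n - (e + 1)), ⟨e + 1, by omega, hI _ _ _ hIτ, ?_, ?_, ?_,
      rfl⟩, ?_⟩
    · simp only [Store.setReg_reg, if_true, f1, f4, hd, h1]
    · simp [f3, hm]
    · simp [f4, h1]
    · have : n - e = n - (e + 1) + 1 := by omega
      rw [this, Nat.mul_add]
      omega
  · exact ⟨0, Nat.zero_le _, hI _ _ _ h0, by simp, by simp [hσ2], by simp [hσ1], by simp⟩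
  · rintro τ t ⟨N', ⟨e, hem, hIe, hd, hm, -, rfl⟩, hn, ht⟩
    have : e = n := by omega
    subst this
    exact ⟨hIe, by omega⟩

end RAM

namespace RAM

/-! ## Residual search -/

/-- The darts `0, …, D - 1` with a given origin form a linked list in decreasing order. Links are
incremented by one, and zero is the end of a list. -/
structure AdjLists (D : ℕ) (org first next : ℕ → ℕ) : Prop where
  first_le : ∀ v, first v ≤ D
  first_last : ∀ v d, first v ≤ d → d < D → org d ≠ v
  first_org : ∀ v, 0 < first v → org (first v - 1) = v
  next_le : ∀ d < D, next d ≤ d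
  next_last : ∀ d < D, ∀ d', next d ≤ d' → d' < d → org d' ≠ org d
  next_org : ∀ d < D, 0 < next d → org (next d - 1) = org d

/-- The darts `0, …, D - 1` of a graph with vertices `0, …, n - 1`: the dart `d` leads from `org d`
to `org (mate d)`. -/
structure DartGraph (n D : ℕ) (org mate first next : ℕ → ℕ) : Prop
    extends AdjLists D org first next where
  org_lt : ∀ d < D, org d < n
  mate_lt : ∀ d < D, mate d < D

/-- The visited vertices form a tree with root `t` and parent darts `par v - 1`. -/
structure SearchTree (n D : ℕ) (org mate res : ℕ → ℕ) (t : ℕ) (vis par rk : ℕ → ℕ) : Prop where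
  root : 0 < vis t
  par_root : par t = 0
  rk_lt : ∀ v < n, 0 < vis v → rk v < n
  tree : ∀ v < n, 0 < vis v → v ≠ t → ∃ d, par v = d + 1 ∧ d < D ∧ 0 < res d ∧
    org (mate d) = v ∧ 0 < vis (org d) ∧ rk (org d) < rk v

/-- The state of the search: the first `qt` entries of `queue` are the visited vertices, those
before position `qh` have been scanned completely, the list of the one at position `qh` has been
scanned up to the link `p`, and `U` is the set of unscanned darts. -/
structure Scanning (n D : ℕ) (org mate res : ℕ → ℕ) (t : ℕ) (vis par queue : ℕ → ℕ)
    (qh qt p : ℕ) (rk : ℕ → ℕ) (U : Finset ℕ) : Prop where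
  root : 0 < vis t
  par_root : par t = 0
  rk_ok : ∀ v < n, 0 < vis v → rk v < qt ∧ queue (rk v) = v
  queue_ok : ∀ i < qt, queue i < n ∧ 0 < vis (queue i) ∧ rk (queue i) = i
  tree : ∀ v < n, 0 < vis v → v ≠ t → ∃ d, par v = d + 1 ∧ d < D ∧ 0 < res d ∧
    org (mate d) = v ∧ 0 < vis (org d) ∧ rk (org d) < rk v
  minimal : ∀ T : Set ℕ, t ∈ T → (∀ d < D, 0 < res d → org d ∈ T → org (mate d) ∈ T) →
    ∀ v < n, 0 < vis v → v ∈ T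
  sub : U ⊆ Finset.range D
  closed : ∀ d < D, d ∉ U → 0 < res d → 0 < vis (org d) → 0 < vis (org (mate d))
  done : ∀ d < D, 0 < vis (org d) → rk (org d) < qh ∨ rk (org d) = qh ∧ p ≤ d → d ∉ U
  todo : ∀ d < D, vis (org d) = 0 ∨ qh < rk (org d) ∨ rk (org d) = qh ∧ d < p → d ∈ U
  cur : qh < qt → p ≤ D ∧ (0 < p → org (p - 1) = queue qh)
  qh_le : qh ≤ qt

section Scanning

variable {n D : ℕ} {org mate first next res : ℕ → ℕ} {t : ℕ} {vis par queue : ℕ → ℕ}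
  {qh qt p : ℕ} {rk : ℕ → ℕ} {U : Finset ℕ}

/-- `rk` inverts `queue`, so no vertex is queued twice. -/
theorem Scanning.qt_le (h : Scanning n D org mate res t vis par queue qh qt p rk U) : qt ≤ n := by
  have := Finset.card_le_card_of_injOn (s := Finset.range qt) (t := Finset.range n) queue
    (fun i hi => by
      simp only [Finset.coe_range, Set.mem_Iio] at hi ⊢
      exact (h.queue_ok i hi).1)
    (fun i hi j hj hij => by
      simp only [Finset.coe_range, Set.mem_Iio] at hi hj
      rw [← (h.queue_ok i hi).2.2, ← (h.queue_ok j hj).2.2, hij])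
  simpa using this

theorem Scanning.searchTree (h : Scanning n D org mate res t vis par queue qh qt p rk U) :
    SearchTree n D org mate res t vis par rk :=
  ⟨h.root, h.par_root, fun v hv hvis => (h.rk_ok v hv hvis).1.trans_le h.qt_le, h.tree⟩

theorem Scanning.closed_of_le (hG : DartGraph n D org mate first next)
    (h : Scanning n D org mate res t vis par queue qh qt p rk U) (hq : qt ≤ qh) :
    ∀ d < D, 0 < res d → 0 < vis (org d) → 0 < vis (org (mate d)) := fun d hd hr hv =>
  h.closed d hd (h.done d hd hv (Or.inl (((h.rk_ok _ (hG.org_lt d hd) hv).1).trans_le hq))) hr hv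

theorem Scanning.init (hG : DartGraph n D org mate first next) (ht : t < n)
    (hvis : ∀ v < n, 0 < vis v ↔ v = t) (hpar : par t = 0) (hq : queue 0 = t) :
    Scanning n D org mate res t vis par queue 0 1 (first t) (fun _ => 0) (Finset.range D) where
  root := (hvis t ht).2 rfl
  par_root := hpar
  rk_ok v hv h := ⟨by omega, hq.trans ((hvis v hv).1 h).symm⟩
  queue_ok i hi := by
    have : i = 0 := by omega
    subst this
    rw [hq]
    exact ⟨ht, (hvis t ht).2 rfl, rfl⟩
  tree v hv h hne := absurd ((hvis v hv).1 h) hne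
  minimal T hT _ v hv h := ((hvis v hv).1 h).symm ▸ hT
  sub := subset_rfl
  closed d hd hU := absurd (Finset.mem_range.2 hd) hU
  done d hd h hd' := by
    have := (hvis _ (hG.org_lt d hd)).1 h
    rcases hd' with h' | h'
    · omega
    · exact absurd this (hG.first_last t d h'.2 hd)
  todo d hd _ := Finset.mem_range.2 hd
  cur _ := ⟨hG.first_le t, fun h => by rw [hq]; exact hG.first_org t h⟩
  qh_le := by omega

/-- With `p = 0` the current list is exhausted. If `qh + 1 = qt`, the queue entry read is
meaningless but harmless, as the search is over. -/
theorem Scanning.pop (hG : DartGraph n D org mate first next)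
    (h : Scanning n D org mate res t vis par queue qh qt 0 rk U) (hq : qh < qt) :
    Scanning n D org mate res t vis par queue (qh + 1) qt (first (queue (qh + 1))) rk U where
  __ := h
  done d hd hv hd' := by
    have hrk := h.rk_ok _ (hG.org_lt d hd) hv
    by_cases h1 : rk (org d) = qh + 1
    · rcases hd' with h' | h'
      · omega
      · rw [h1] at hrk
        exact absurd hrk.2.symm (hG.first_last _ d h'.2 hd)
    · exact h.done d hd hv (by omega)
  todo d hd hd' := h.todo d hd (by omega)
  cur _ := ⟨hG.first_le _, fun h' => hG.first_org _ h'⟩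
  qh_le := hq

/-- No dart strictly between the end of the new link and `p - 1` has the same origin, so removing `p
- 1` alone from `U` is enough. -/
theorem Scanning.skipDart (hG : DartGraph n D org mate first next)
    (h : Scanning n D org mate res t vis par queue qh qt p rk U) (hq : qh < qt) (hp : 0 < p)
    (hnew : 0 < res (p - 1) → 0 < vis (org (mate (p - 1)))) :
    Scanning n D org mate res t vis par queue qh qt (next (p - 1)) rk (U.erase (p - 1)) := by
  obtain ⟨hpD, horg⟩ := h.cur hq
  have horg := horg hp
  obtain ⟨hqn, hqv, hqr⟩ := h.queue_ok qh hq
  have hlt : p - 1 < D := by omega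
  have hnext := hG.next_le _ hlt
  exact
  { h with
    sub := (Finset.erase_subset _ _).trans h.sub
    closed := fun d hd hU hr hv => by
      by_cases hdp : d = p - 1
      · subst hdp
        exact hnew hr
      · exact h.closed d hd (fun h' => hU (Finset.mem_erase.2 ⟨hdp, h'⟩)) hr hv
    done := fun d hd hv hd' hU => by
      obtain ⟨hne, hU⟩ := Finset.mem_erase.1 hU
      refine h.done d hd hv ?_ hU
      rcases hd' with h' | h'
      · exact Or.inl h'
      · refine Or.inr ⟨h'.1, ?_⟩
        by_contra hcon
        refine hG.next_last _ hlt d h'.2 (by omega) ?_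
        have := (h.rk_ok _ (hG.org_lt d hd) hv).2
        rw [← this, h'.1, horg]
    todo := fun d hd hd' => by
      refine Finset.mem_erase.2 ⟨?_, h.todo d hd (by omega)⟩
      rintro rfl
      rw [horg, hqr] at hd'
      omega
    cur := fun _ => ⟨by omega, fun h' => (hG.next_org _ hlt h').trans horg⟩ }

theorem Scanning.mem_of_pos (h : Scanning n D org mate res t vis par queue qh qt p rk U)
    (hq : qh < qt) (hp : 0 < p) : p - 1 ∈ U := by
  obtain ⟨hpD, horg⟩ := h.cur hq
  have hqr := (h.queue_ok qh hq).2.2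
  refine h.todo _ (by omega) (Or.inr (Or.inr ⟨?_, by omega⟩))
  rw [horg hp, hqr]

/-- The new vertex gets rank `qt`, above its parent. All its darts are still in `U`, so closedness
under scanned darts is not endangered; `p - 1` itself is removed afterwards by `Scanning.skipDart`.
-/
theorem Scanning.discover (hG : DartGraph n D org mate first next)
    (h : Scanning n D org mate res t vis par queue qh qt p rk U) (hq : qh < qt) (hp : 0 < p)
    (hres : 0 < res (p - 1)) (hw : vis (org (mate (p - 1))) = 0) :
    Scanning n D org mate res t (Function.update vis (org (mate (p - 1))) 1)
      (Function.update par (org (mate (p - 1))) p)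
      (Function.update queue qt (org (mate (p - 1)))) qh (qt + 1) p
      (Function.update rk (org (mate (p - 1))) qt) U := by
  obtain ⟨hpD, horg⟩ := h.cur hq
  have horg := horg hp
  obtain ⟨hqn, hqv, hqr⟩ := h.queue_ok qh hq
  have hlt : p - 1 < D := by omega
  have hmate := hG.mate_lt _ hlt
  have hwn := hG.org_lt _ hmate
  set w := org (mate (p - 1)) with hwdef
  have hwt : t ≠ w := by
    rintro rfl
    have := h.root
    omega
  have hvis : ∀ v, 0 < Function.update vis w 1 v ↔ v = w ∨ 0 < vis v := by
    intro v
    by_cases hv : v = w <;> simp [hv]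
  have hne : ∀ v, 0 < vis v → v ≠ w := by
    rintro v hv rfl
    omega
  constructor
  · exact (hvis t).2 (Or.inr h.root)
  · rw [Function.update_of_ne hwt, h.par_root]
  · intro v hv hvv
    by_cases hvw : v = w
    · subst hvw
      simp
    · have := h.rk_ok v hv (((hvis v).1 hvv).resolve_left hvw)
      rw [Function.update_of_ne hvw, Function.update_of_ne (by omega)]
      exact ⟨by omega, this.2⟩
  · intro i hi
    by_cases hiq : i = qt
    · subst hiq
      simp [hwn]
    · obtain ⟨h1, h2, h3⟩ := h.queue_ok i (by omega)
      rw [Function.update_of_ne hiq, hvis, Function.update_of_ne (hne _ h2)]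
      exact ⟨h1, Or.inr h2, h3⟩
  · intro v hv hvv hvt
    by_cases hvw : v = w
    · subst hvw
      refine ⟨p - 1, ?_, hlt, hres, rfl, (hvis _).2 (Or.inr (horg ▸ hqv)), ?_⟩
      · rw [Function.update_self]
        omega
      · rw [Function.update_self, horg, Function.update_of_ne (hne _ hqv), hqr]
        exact hq
    · obtain ⟨d, h1, h2, h3, h4, h5, h6⟩ := h.tree v hv (((hvis v).1 hvv).resolve_left hvw) hvt
      refine ⟨d, ?_, h2, h3, h4, (hvis _).2 (Or.inr h5), ?_⟩
      · rw [Function.update_of_ne hvw, h1]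
      · rw [Function.update_of_ne hvw, Function.update_of_ne (hne _ h5)]
        exact h6
  · intro T hT hcl v hv hvv
    obtain rfl | hvv := (hvis v).1 hvv
    · refine hcl _ hlt hres ?_
      rw [horg]
      exact h.minimal T hT hcl _ hqn hqv
    · exact h.minimal T hT hcl v hv hvv
  · exact h.sub
  · intro d hd hU hr hv
    obtain hv | hv := (hvis _).1 hv
    · exact absurd (h.todo d hd (Or.inl (hv ▸ hw))) hU
    · exact (hvis _).2 (Or.inr (h.closed d hd hU hr hv))
  · intro d hd hv hd'
    by_cases hvw : org d = w
    · rw [hvw, Function.update_self] at hd'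
      omega
    · rw [Function.update_of_ne hvw] at hd'
      exact h.done d hd (((hvis _).1 hv).resolve_left hvw) hd'
  · intro d hd hd'
    by_cases hvw : org d = w
    · exact h.todo d hd (Or.inl (hvw ▸ hw))
    · rw [Function.update_of_ne hvw, Function.update_of_ne hvw] at hd'
      exact h.todo d hd hd'
  · intro _
    rw [Function.update_of_ne (by omega)]
    exact ⟨hpD, fun _ => horg⟩
  · have := h.qh_le
    omega

end Scanning

def scan : Cmd :=
  .ite .zero .p
    -- Subtracting `zero` serves as assignment. The old link, saved in `x`, is the dart plus one,
    -- just the format of `par`.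
    (.sub .x .p .zero ;; .sub .d .p .one ;; .get .p .next .d ;; .get .z .res .d ;;
      .ite .zero .z
        (.get .d2 .mate .d ;; .get .w .org .d2 ;; .get .z .vis .w ;;
          .ite .z .one
            (.put .vis .w .one ;; .put .par .w .x ;; .put .queue .qt .w ;; .add .qt .qt .one ;;
              .get .z .tok .w ;;
              -- Emptying the queue makes the surrounding loop stop.
              .ite .zero .z (.sub .fnd .one .zero ;; .sub .qt .zero .zero) .skip)
            .skip)
        .skip)
    (.add .qh .qh .one ;; .get .z .queue .qh ;; .get .p .first .z)

/-- Search for a vertex with an unused token from which `t` can be reached in the residual graph,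
backwards from `t`. -/
def search : Cmd :=
  forVerts (.put .vis .v .zero) ;; .put .vis .t .one ;; .put .par .t .zero ;;
    .sub .qh .zero .zero ;; .put .queue .qh .t ;; .sub .qt .one .zero ;; .sub .fnd .zero .zero ;;
    .get .p .first .t ;; .while .qh .qt scan

/-- Termination measure: each step either removes an unscanned dart or advances `qh`, so `U.card +
(n - qh)` drops unless a token is found. -/
theorem wp_scan {B M n D t : ℕ} {org mate first next res tok : ℕ → ℕ}
    (hG : DartGraph n D org mate first next) (hB : n ≤ B) {σ : Store}
    (h1 : σ.reg .one = 1) (h0 : σ.reg .zero = 0) (ho : σ.arr .org = org)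
    (hm : σ.arr .mate = mate) (hf : σ.arr .first = first) (hn : σ.arr .next = next)
    (hr : σ.arr .res = res) (ht : σ.arr .tok = tok)
    (hq : σ.reg .qh < σ.reg .qt) {rk : ℕ → ℕ} {U : Finset ℕ}
    (hfnd : σ.reg .fnd = 0) (hclean : ∀ v < n, 0 < σ.arr .vis v → v ≠ t → tok v = 0)
    (h : Scanning n D org mate res t (σ.arr .vis) (σ.arr .par) (σ.arr .queue) (σ.reg .qh)
      (σ.reg .qt) (σ.reg .p) rk U) :
    WP B M scan σ fun τ T => T ≤ 19 ∧
      ((τ.reg .fnd = 0 ∧ (∀ v < n, 0 < τ.arr .vis v → v ≠ t → tok v = 0) ∧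
        ∃ rk U', Scanning n D org mate res t (τ.arr .vis) (τ.arr .par) (τ.arr .queue) (τ.reg .qh)
          (τ.reg .qt) (τ.reg .p) rk U' ∧ U'.card + (n - τ.reg .qh) + 1 ≤
            U.card + (n - σ.reg .qh)) ∨
      (τ.reg .fnd = 1 ∧ τ.reg .qt = 0 ∧ τ.reg .w < n ∧ τ.reg .w ≠ t ∧ 0 < tok (τ.reg .w) ∧
        0 < τ.arr .vis (τ.reg .w) ∧
        ∃ rk, SearchTree n D org mate res t (τ.arr .vis) (τ.arr .par) rk)) := by
  have hqn := h.qt_le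
  rw [scan, wp_ite, h0]
  constructor
  · intro hp
    have hU := Finset.card_erase_add_one (h.mem_of_pos hq hp)
    obtain ⟨hpD, -⟩ := h.cur hq
    simp only [wp_seq, wp_sub, wp_get, wp_ite, wp_put, wp_add, wp_skip, Store.setReg_reg,
      Store.setReg_arr, Store.setArr_reg, Store.setArr_arr, reduceCtorEq, if_false, if_true, h0, h1,
      ho, hm, hn, hr, ht, false_imp_iff, true_and, Nat.sub_zero]
    refine ⟨fun hres => ⟨fun hvis => ⟨?_, fun htok => ⟨by omega, Or.inr ?_⟩,
      fun htok => ⟨by omega, Or.inl ?_⟩⟩, fun hvis => ⟨by omega, Or.inl ?_⟩⟩,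
      fun hres => ⟨by omega, Or.inl ?_⟩⟩
    · have := (h.discover hG hq hp hres (by omega)).qt_le
      omega
    · have hd := h.discover hG hq hp hres (by omega)
      refine ⟨hG.org_lt _ (hG.mate_lt _ (by omega)), ?_, htok, by simp, _,
        hd.searchTree⟩
      intro hwt
      have := h.root
      rw [hwt] at hvis
      omega
    · have hd := h.discover hG hq hp hres (by omega)
      refine ⟨hfnd, ?_, _, _, hd.skipDart hG (by omega) hp (by simp), by omega⟩
      intro v hv hvv hvt
      by_cases hvw : v = org (mate (σ.reg .p - 1))
      · rw [hvw]
        omega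
      · rw [Function.update_of_ne hvw] at hvv
        exact hclean v hv hvv hvt
    · exact ⟨hfnd, hclean, _, _, h.skipDart hG hq hp (fun _ => by omega), by omega⟩
    · exact ⟨hfnd, hclean, _, _, h.skipDart hG hq hp (fun h' => absurd h' hres), by omega⟩
  · intro hp
    have hp0 : σ.reg .p = 0 := by omega
    simp only [wp_seq, wp_get, wp_add, Store.setReg_reg,
      Store.setReg_arr, reduceCtorEq, if_false, if_true, h1, hf, false_imp_iff, true_and]
    refine ⟨by omega, by omega, Or.inl ⟨hfnd, hclean, rk, U, ?_, by omega⟩⟩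
    rw [hp0] at h
    exact h.pop hG hq

/-- The result of a failed search. -/
structure SearchClosed (n D : ℕ) (org mate res tok : ℕ → ℕ) (t : ℕ) (vis : ℕ → ℕ) : Prop where
  root : 0 < vis t
  clean : ∀ v < n, 0 < vis v → v ≠ t → tok v = 0
  closed : ∀ d < D, 0 < res d → 0 < vis (org d) → 0 < vis (org (mate d))
  minimal : ∀ T : Set ℕ, t ∈ T → (∀ d < D, 0 < res d → org d ∈ T → org (mate d) ∈ T) →
    ∀ v < n, 0 < vis v → v ∈ T

theorem wp_search {B M n D : ℕ} {σ : Store}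
    (hG : DartGraph n D (σ.arr .org) (σ.arr .mate) (σ.arr .first) (σ.arr .next)) (hB : n ≤ B)
    (h1 : σ.reg .one = 1) (h0 : σ.reg .zero = 0) (hn : σ.reg .n = n) (ht : σ.reg .t < n) :
    WP B M search σ fun τ T => T ≤ 20 * (n + D) + 3 * n + 20 ∧
      ((τ.reg .fnd = 0 ∧ SearchClosed n D (σ.arr .org) (σ.arr .mate) (σ.arr .res) (σ.arr .tok)
          (σ.reg .t) (τ.arr .vis)) ∨
      (τ.reg .fnd = 1 ∧ τ.reg .w < n ∧ τ.reg .w ≠ σ.reg .t ∧ 0 < σ.arr .tok (τ.reg .w) ∧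
        0 < τ.arr .vis (τ.reg .w) ∧
        ∃ rk, SearchTree n D (σ.arr .org) (σ.arr .mate) (σ.arr .res) (σ.reg .t) (τ.arr .vis)
          (τ.arr .par) rk)) := by
  have hclear : WP B M (forVerts (.put .vis .v .zero)) σ fun τ T =>
      (τ.reg .zero = 0 ∧ ∀ v < n, τ.arr .vis v = 0) ∧ T ≤ (1 + 2) * n + 2 := by
    refine wp_forVerts (fun j τ => τ.reg .zero = 0 ∧ ∀ v < j, τ.arr .vis v = 0) (by decide) hB
      ?_ ?_ ⟨h0, by simp⟩ hn h1
    · intro e τ b hI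
      simpa using hI
    · intro e he τ hI hv _ _
      rw [wp_put]
      refine ⟨by simp, ⟨hI.1, fun v hve => ?_⟩, le_rfl⟩
      simp only [Store.setArr_arr, if_true, hv, hI.1, Function.update_apply]
      split_ifs with h
      · rfl
      · exact hI.2 v (by omega)
  refine WP.seq hclear.frame ?_
  rintro τ T ⟨⟨⟨h0', hvis⟩, hT⟩, hreg, harr⟩
  have e1 := hreg .one (by decide)
  have e2 := hreg .t (by decide)
  have a1 := harr .org (by decide)
  have a2 := harr .mate (by decide)
  have a3 := harr .first (by decide)
  have a4 := harr .next (by decide)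
  have a5 := harr .res (by decide)
  have a6 := harr .tok (by decide)
  rw [h1] at e1
  simp only [wp_seq, wp_sub, wp_get, wp_put, Store.setReg_reg,
    Store.setReg_arr, Store.setArr_reg, Store.setArr_arr, reduceCtorEq, if_false, if_true, h0', e1,
    false_imp_iff, true_and, Nat.sub_zero]
  refine (wp_while (fun N τ' => τ'.reg .one = 1 ∧ τ'.reg .zero = 0 ∧
    τ'.arr .org = σ.arr .org ∧ τ'.arr .mate = σ.arr .mate ∧ τ'.arr .first = σ.arr .first ∧
    τ'.arr .next = σ.arr .next ∧ τ'.arr .res = σ.arr .res ∧ τ'.arr .tok = σ.arr .tok ∧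
    ((τ'.reg .fnd = 0 ∧ (∀ v < n, 0 < τ'.arr .vis v → v ≠ σ.reg .t → σ.arr .tok v = 0) ∧
      ∃ rk U, Scanning n D (σ.arr .org) (σ.arr .mate) (σ.arr .res) (σ.reg .t) (τ'.arr .vis)
        (τ'.arr .par) (τ'.arr .queue) (τ'.reg .qh) (τ'.reg .qt) (τ'.reg .p) rk U ∧
        N = 20 * (U.card + (n - τ'.reg .qh))) ∨
    (τ'.reg .fnd = 1 ∧ τ'.reg .qt = 0 ∧ τ'.reg .w < n ∧ τ'.reg .w ≠ σ.reg .t ∧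
      0 < σ.arr .tok (τ'.reg .w) ∧ 0 < τ'.arr .vis (τ'.reg .w) ∧
      ∃ rk, SearchTree n D (σ.arr .org) (σ.arr .mate) (σ.arr .res) (σ.reg .t) (τ'.arr .vis)
        (τ'.arr .par) rk))) ?_ (20 * (n + D)) _ ?_).imp ?_
  · rintro N τ' ⟨b1, b2, b3, b4, b5, b6, b7, b8, hI⟩ hlt
    rcases hI with ⟨hfnd, hclean, rk, U, hS, rfl⟩ | ⟨-, hqt, -⟩
    · refine (wp_scan hG hB b1 b2 b3 b4 b5 b6 b7 b8 hlt hfnd hclean hS).frame.imp ?_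
      rintro ρ T' ⟨⟨hT', hcase⟩, hreg', harr'⟩
      have c1 := (hreg' .one (by decide)).trans b1
      have c2 := (hreg' .zero (by decide)).trans b2
      have c3 := (harr' .org (by decide)).trans b3
      have c4 := (harr' .mate (by decide)).trans b4
      have c5 := (harr' .first (by decide)).trans b5
      have c6 := (harr' .next (by decide)).trans b6
      have c7 := (harr' .res (by decide)).trans b7
      have c8 := (harr' .tok (by decide)).trans b8
      rcases hcase with ⟨g1, g2, rk', U', g3, g4⟩ | hcase
      · exact ⟨_, ⟨c1, c2, c3, c4, c5, c6, c7, c8, Or.inl ⟨g1, g2, rk', U', g3, rfl⟩⟩, by omega⟩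
      · have := hS.qt_le
        exact ⟨0, ⟨c1, c2, c3, c4, c5, c6, c7, c8, Or.inr hcase⟩, by omega⟩
    · omega
  · simp only [Store.setReg_reg,
      Store.setReg_arr, Store.setArr_reg, Store.setArr_arr, reduceCtorEq, if_false, if_true,
      h0', e1, e2, a1, a2, a3, a4, a5, a6, true_and]
    have hvis' : ∀ v < n, 0 < Function.update (τ.arr .vis) (σ.reg .t) 1 v ↔ v = σ.reg .t := by
      intro v hv
      by_cases hvt : v = σ.reg .t
      · simp [hvt]
      · simp [hvt, hvis v hv]
    left
    refine ⟨fun v hv hvv hne => absurd ((hvis' v hv).1 hvv) hne, _, _,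
      Scanning.init hG ht hvis' (by simp) (by simp), ?_⟩
    simp
    omega
  · rintro ρ T' ⟨N', ⟨-, -, -, -, -, -, -, -, hI⟩, hlt, hT'⟩
    refine ⟨by omega, ?_⟩
    rcases hI with ⟨hfnd, hclean, rk, U, hS, rfl⟩ | ⟨g1, -, g2⟩
    · exact Or.inl ⟨hfnd, hS.root, hclean, hS.closed_of_le hG (by omega), hS.minimal⟩
    · exact Or.inr ⟨g1, g2⟩

end RAM

namespace RAM

/-! ## Loading the graph -/

/-- The new dart is the largest one, so prepending it keeps the list of `v` decreasing. -/
theorem AdjLists.addDart {D : ℕ} {org first next : ℕ → ℕ} (h : AdjLists D org first next)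
    (v : ℕ) :
    AdjLists (D + 1) (Function.update org D v) (Function.update first v (D + 1))
      (Function.update next D (first v)) where
  first_le w := by
    have := h.first_le w
    rw [Function.update_apply]
    split_ifs <;> omega
  first_last w d hw hd := by
    by_cases hwv : w = v
    · subst hwv
      rw [Function.update_self] at hw
      omega
    · rw [Function.update_of_ne hwv] at hw
      by_cases hdD : d = D
      · subst hdD
        rw [Function.update_self]
        exact Ne.symm hwv
      · rw [Function.update_of_ne hdD]
        exact h.first_last w d hw (by omega)
  first_org w := by
    by_cases hw : w = v
    · subst hw
      simp
    · have := h.first_le w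
      rw [Function.update_of_ne hw]
      intro hpos
      rw [Function.update_of_ne (by omega)]
      exact h.first_org w hpos
  next_le d hd := by
    rw [Function.update_apply]
    split_ifs with h1
    · rw [h1]
      exact h.first_le v
    · exact h.next_le d (by omega)
  next_last d hd d' h1 h2 := by
    rw [Function.update_of_ne (show d' ≠ D by omega)]
    by_cases hdD : d = D
    · subst hdD
      rw [Function.update_self] at h1 ⊢
      exact h.first_last v d' h1 h2
    · rw [Function.update_of_ne hdD] at h1 ⊢
      exact h.next_last d (by omega) d' h1 h2
  next_org d hd := by
    by_cases hdD : d = D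
    · subst hdD
      rw [Function.update_self, Function.update_self]
      intro hpos
      have := h.first_le v
      rw [Function.update_of_ne (by omega)]
      exact h.first_org v hpos
    · rw [Function.update_of_ne hdD, Function.update_of_ne hdD]
      intro hpos
      have := h.next_le d (by omega)
      rw [Function.update_of_ne (by omega)]
      exact h.next_org d (by omega) hpos

variable {n m : ℕ} {G : MDigraph (Fin n) (Fin m)}

/-- The arrays represent the first `j` edges of `G`. The edge `e` has the two darts `2 * e`, from
tail to head, and `2 * e + 1`, from head to tail. -/
structure Loaded (G : MDigraph (Fin n) (Fin m)) (j : ℕ) (arr : Arr → ℕ → ℕ) : Prop where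
  org_tail : ∀ e : Fin m, (e : ℕ) < j → arr .org (2 * e) = G.tail e
  org_head : ∀ e : Fin m, (e : ℕ) < j → arr .org (2 * e + 1) = G.head e
  mate_tail : ∀ e : Fin m, (e : ℕ) < j → arr .mate (2 * e) = 2 * e + 1
  mate_head : ∀ e : Fin m, (e : ℕ) < j → arr .mate (2 * e + 1) = 2 * e
  adj : AdjLists (2 * j) (arr .org) (arr .first) (arr .next)

theorem exists_edge {d : ℕ} (hd : d < 2 * m) : ∃ e : Fin m, d = 2 * e ∨ d = 2 * e + 1 :=
  ⟨⟨d / 2, by omega⟩, by simp only; omega⟩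

theorem Loaded.dartGraph {arr : Arr → ℕ → ℕ} (h : Loaded G m arr) :
    DartGraph n (2 * m) (arr .org) (arr .mate) (arr .first) (arr .next) where
  __ := h.adj
  org_lt d hd := by
    obtain ⟨e, rfl | rfl⟩ := exists_edge hd
    · rw [h.org_tail e e.2]
      exact (G.tail e).2
    · rw [h.org_head e e.2]
      exact (G.head e).2
  mate_lt d hd := by
    obtain ⟨e, rfl | rfl⟩ := exists_edge hd
    · rw [h.mate_tail e e.2]
      omega
    · rw [h.mate_head e e.2]
      omega

theorem Loaded.congr {j : ℕ} {arr arr' : Arr → ℕ → ℕ} (h : Loaded G j arr)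
    (h1 : arr' .org = arr .org) (h2 : arr' .mate = arr .mate) (h3 : arr' .first = arr .first)
    (h4 : arr' .next = arr .next) : Loaded G j arr' :=
  ⟨h1 ▸ h.org_tail, h1 ▸ h.org_head, h2 ▸ h.mate_tail, h2 ▸ h.mate_head,
    by rw [h1, h3, h4]; exact h.adj⟩

/-- The array `alive` represents the edge set `A`. -/
def Alive (A : Finset (Fin m)) (arr : Arr → ℕ → ℕ) : Prop :=
  ∀ e : Fin m, arr .alive (2 * e + 1) = if e ∈ A then 1 else 0

/-- For a loop the second insertion must see the first, so `first` is read again after its update.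
The edge becomes alive only if its head differs from `s`, which is tested by two strict comparisons.
-/
def loadEdge : Cmd :=
  .get .v .io .d ;; .get .w .io .d2 ;; .put .org .d .v ;; .put .org .d2 .w ;;
    .put .mate .d .d2 ;; .put .mate .d2 .d ;;
    .get .x .first .v ;; .put .next .d .x ;; .put .first .v .d2 ;;
    .add .z .d2 .one ;;
    .get .x .first .w ;; .put .next .d2 .x ;; .put .first .w .z ;;
    .ite .w .s (.put .alive .d2 .one) (.ite .s .w (.put .alive .d2 .one) .skip)

theorem wp_loadEdges {B : ℕ} {s : Fin n} {σ : Store} (hB : 2 * m ≤ B) (h1 : σ.reg .one = 1)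
    (hm2 : σ.reg .m2 = 2 * m) (hs : σ.reg .s = s)
    (hio : ∀ e : Fin m, σ.arr .io (2 * e) = G.tail e ∧ σ.arr .io (2 * e + 1) = G.head e)
    (hzero : ∀ a, a ≠ .io → ∀ i, σ.arr a i = 0) :
    WP B (2 * m) (forEdges .d .d2 loadEdge) σ fun τ T => T ≤ 19 * m + 2 ∧
      Loaded G m τ.arr ∧ Alive (Finset.univ \ G.inEdges Finset.univ s) τ.arr := by
  refine (wp_forEdges (c := 16) (fun j τ => τ.reg .s = s ∧ τ.arr .io = σ.arr .io ∧
    Loaded G j τ.arr ∧ ∀ e : Fin m, τ.arr .alive (2 * e + 1) =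
      if (e : ℕ) < j ∧ G.head e ≠ s then 1 else 0) (by decide) (by decide) (by decide)
    (by decide) hB ?_ ?_ ?_ hm2 h1).imp ?_
  · rintro e τ b ⟨g1, g2, g3, g4⟩
    exact ⟨⟨by simpa using g1, g2, g3, g4⟩, ⟨by simpa using g1, g2, g3, g4⟩⟩
  · rintro j hj τ ⟨g1, g2, g3, g4⟩ hd hd2 _ hone
    obtain ⟨ht, hh⟩ := hio ⟨j, hj⟩
    simp only at ht hh
    have hL : ∀ arr : Arr → ℕ → ℕ,
        arr .org = Function.update (Function.update (τ.arr .org) (2 * j) (G.tail ⟨j, hj⟩))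
          (2 * j + 1) (G.head ⟨j, hj⟩) →
        arr .mate = Function.update (Function.update (τ.arr .mate) (2 * j) (2 * j + 1))
          (2 * j + 1) (2 * j) →
        arr .first = Function.update (Function.update (τ.arr .first) (G.tail ⟨j, hj⟩)
          (2 * j + 1)) (G.head ⟨j, hj⟩) (2 * j + 1 + 1) →
        arr .next = Function.update (Function.update (τ.arr .next) (2 * j)
          (τ.arr .first (G.tail ⟨j, hj⟩))) (2 * j + 1)
          (Function.update (τ.arr .first) (G.tail ⟨j, hj⟩) (2 * j + 1) (G.head ⟨j, hj⟩)) →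
        Loaded G (j + 1) arr := by
      intro arr e1 e2 e3 e4
      have hlast : ∀ e : Fin m, (e : ℕ) < j + 1 → ¬ (e : ℕ) < j → e = ⟨j, hj⟩ := fun e h h' =>
        Fin.ext (by simp only; omega)
      constructor
      · intro e he
        by_cases hej : (e : ℕ) < j
        · rw [e1, Function.update_of_ne (by omega), Function.update_of_ne (by omega),
            g3.org_tail e hej]
        · rw [hlast e he hej, e1, Function.update_of_ne (by simp only; omega)]
          exact Function.update_self ..
      · intro e he
        by_cases hej : (e : ℕ) < j
        · rw [e1, Function.update_of_ne (by omega), Function.update_of_ne (by omega),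
            g3.org_head e hej]
        · rw [hlast e he hej, e1]
          exact Function.update_self ..
      · intro e he
        by_cases hej : (e : ℕ) < j
        · rw [e2, Function.update_of_ne (by omega), Function.update_of_ne (by omega),
            g3.mate_tail e hej]
        · rw [hlast e he hej, e2, Function.update_of_ne (by simp only; omega)]
          exact Function.update_self ..
      · intro e he
        by_cases hej : (e : ℕ) < j
        · rw [e2, Function.update_of_ne (by omega), Function.update_of_ne (by omega),
            g3.mate_head e hej]
        · rw [hlast e he hej, e2]
          exact Function.update_self ..
      · have := (g3.adj.addDart (G.tail ⟨j, hj⟩)).addDart (G.head ⟨j, hj⟩)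
        rw [e1, e3, e4]
        exact this
    have hA : ∀ al : ℕ → ℕ, al = (if G.head ⟨j, hj⟩ = s then τ.arr .alive else
          Function.update (τ.arr .alive) (2 * j + 1) 1) →
        ∀ e : Fin m, al (2 * e + 1) = if (e : ℕ) < j + 1 ∧ G.head e ≠ s then 1 else 0 := by
      intro al e1 e
      rw [e1]
      by_cases hej : (e : ℕ) = j
      · have : e = ⟨j, hj⟩ := Fin.ext hej
        subst this
        by_cases hes : G.head ⟨j, hj⟩ = s
        · rw [if_pos hes, g4]
          simp [hes]
        · rw [if_neg hes]
          simp [hes]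
      · have h' : (e : ℕ) < j + 1 ↔ (e : ℕ) < j := by omega
        simp only [h']
        split_ifs with h2 h3 h3
        · rw [g4, if_pos h3]
        · rw [g4, if_neg h3]
        · rw [Function.update_of_ne (by omega), g4, if_pos h3]
        · rw [Function.update_of_ne (by omega), g4, if_neg h3]
    simp only [loadEdge, wp_seq, wp_get, wp_ite, wp_put, wp_add, wp_skip, Store.setReg_reg,
      Store.setReg_arr, Store.setArr_reg, Store.setArr_arr, reduceCtorEq, if_false, if_true,
      false_imp_iff, true_and, hd, hd2, hone, g1, g2, ht, hh, forall_true_left]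
    refine ⟨by omega, by omega, by omega, fun hlt => ⟨⟨hL _ ?_ ?_ ?_ ?_, hA _ ?_⟩, by omega⟩,
      fun hlt => ⟨fun hlt' => ⟨⟨hL _ ?_ ?_ ?_ ?_, hA _ ?_⟩, by omega⟩,
      fun hlt' => ⟨⟨hL _ ?_ ?_ ?_ ?_, hA _ ?_⟩, by omega⟩⟩⟩
    all_goals try simp
    · intro h
      have := congrArg Fin.val h
      omega
    · intro h
      have := congrArg Fin.val h
      omega
    · exact fun h => absurd (Fin.ext (by omega)) h
  · refine ⟨hs, rfl, ⟨by simp, by simp, by simp, by simp, ?_⟩, ?_⟩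
    · constructor <;> simp [hzero]
    · simp [hzero]
  · rintro τ T ⟨⟨-, -, g3, g4⟩, hT⟩
    refine ⟨by omega, g3, fun e => ?_⟩
    rw [g4]
    simp [MDigraph.inEdges]

/-! ## Augmentation -/

/-- The array `res` represents the residual graph of the flow `f` in the graph `A`. -/
structure Residual (A f : Finset (Fin m)) (res : ℕ → ℕ) : Prop where
  tail : ∀ e : Fin m, res (2 * e) = if e ∈ f then 1 else 0
  head : ∀ e : Fin m, res (2 * e + 1) = if e ∈ A ∧ e ∉ f then 1 else 0

theorem Residual.insert {A f : Finset (Fin m)} {res : ℕ → ℕ} (h : Residual A f res) (e : Fin m) :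
    Residual A (insert e f)
      (Function.update (Function.update res (2 * e + 1) 0) (2 * e) 1) where
  tail e' := by
    by_cases he : e' = e
    · simp [he]
    · have : (e' : ℕ) ≠ e := fun h' => he (Fin.ext h')
      rw [Function.update_of_ne (by omega), Function.update_of_ne (by omega), h.tail]
      simp [he]
  head e' := by
    by_cases he : e' = e
    · subst he
      rw [Function.update_of_ne (by omega)]
      simp
    · have : (e' : ℕ) ≠ e := fun h' => he (Fin.ext h')
      rw [Function.update_of_ne (by omega), Function.update_of_ne (by omega), h.head]
      simp [he]

theorem Residual.erase {A f : Finset (Fin m)} {res : ℕ → ℕ} (h : Residual A f res) {e : Fin m}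
    (heA : e ∈ A) :
    Residual A (f.erase e)
      (Function.update (Function.update res (2 * e) 0) (2 * e + 1) 1) where
  tail e' := by
    by_cases he : e' = e
    · subst he
      rw [Function.update_of_ne (by omega)]
      simp
    · have : (e' : ℕ) ≠ e := fun h' => he (Fin.ext h')
      rw [Function.update_of_ne (by omega), Function.update_of_ne (by omega), h.tail]
      simp [he]
  head e' := by
    by_cases he : e' = e
    · simp [he, heA]
    · have : (e' : ℕ) ≠ e := fun h' => he (Fin.ext h')
      rw [Function.update_of_ne (by omega), Function.update_of_ne (by omega), h.head]
      simp [he]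

/-- As the search ran backwards, the parent dart leads from the next vertex of the augmenting path
to the present one. The link `0` at the root `t` ends the loop. -/
def augment : Cmd :=
  .get .x .tok .w ;; .sub .x .x .one ;; .put .tok .w .x ;; .get .x .par .w ;;
    .while .zero .x
      (.sub .d .x .one ;; .get .d2 .mate .d ;; .put .res .d .zero ;; .put .res .d2 .one ;;
        .get .w .org .d ;; .get .x .par .w)

theorem wp_augment {B M : ℕ} {σ : Store} {A f : Finset (Fin m)} {t w : Fin n} {u : Fin n → ℕ}
    {rk : ℕ → ℕ} (hL : Loaded G m σ.arr) (hres : Residual A f (σ.arr .res))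
    (hf : G.IsFlow A f t u) (h1 : σ.reg .one = 1) (h0 : σ.reg .zero = 0) (hw : σ.reg .w = w)
    (hwv : 0 < σ.arr .vis w)
    (htree : SearchTree n (2 * m) (σ.arr .org) (σ.arr .mate) (σ.arr .res) t (σ.arr .vis)
      (σ.arr .par) rk) :
    WP B M augment σ fun τ T => T ≤ 8 * n + 8 ∧
      (τ.arr .tok = Function.update (σ.arr .tok) w (σ.arr .tok w - 1)) ∧
      ∃ f', Residual A f' (τ.arr .res) ∧
        G.IsFlow A f' t (fun y => u y + if y = w then 1 else 0) ∧
        ∀ e ∈ f, G.head e = t → e ∈ f' := by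
  simp only [augment, wp_seq, wp_get, wp_sub, wp_put, Store.setReg_reg,
      Store.setReg_arr, Store.setArr_reg, Store.setArr_arr, reduceCtorEq, if_false, if_true,
      false_imp_iff, true_and, h1, hw]
  refine (wp_while (fun N τ => τ.reg .one = 1 ∧ τ.reg .zero = 0 ∧ τ.arr .org = σ.arr .org ∧
    τ.arr .mate = σ.arr .mate ∧ τ.arr .par = σ.arr .par ∧
    τ.arr .tok = Function.update (σ.arr .tok) w (σ.arr .tok w - 1) ∧
    ∃ (y : Fin n) (f' : Finset (Fin m)), τ.reg .x = σ.arr .par y ∧ 0 < σ.arr .vis y ∧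
      Residual A f' (τ.arr .res) ∧
      G.IsPendingFlow A f' t (fun y => u y + if y = w then 1 else 0) y ∧
      (∀ e ∈ f, G.head e = t → e ∈ f') ∧
      (∀ v < n, 0 < σ.arr .vis v → v ≠ t → rk v ≤ rk y → 0 < τ.arr .res (σ.arr .par v - 1)) ∧
      N = 8 * rk y) ?_ (8 * rk w) _ ?_).imp ?_
  · rintro N τ ⟨b1, b2, b3, b4, b5, b6, y, f', hx, hy, hR, hP, hmono, hpos, rfl⟩ hlt
    rw [b2, hx] at hlt
    have hyt : (y : ℕ) ≠ t := by
      intro h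
      rw [h, htree.par_root] at hlt
      omega
    obtain ⟨d, hpar, hdD, -, horg, hvo, hrk⟩ := htree.tree y y.2 hy hyt
    have hresd := hpos y y.2 hy hyt le_rfl
    have hOrg := hL.dartGraph.org_lt d hdD
    -- The darts still to be followed lead to vertices of smaller rank, so they differ from `d` and
    -- keep their residual capacity.
    have hkeep : ∀ v < n, 0 < σ.arr .vis v → v ≠ t → rk v ≤ rk (σ.arr .org d) →
        0 < Function.update (Function.update (τ.arr .res) d 0) (σ.arr .mate d) 1
          (σ.arr .par v - 1) := by
      intro v hv hvv hvt hle
      obtain ⟨d', hpar', -, -, horg', -, -⟩ := htree.tree v hv hvv hvt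
      have hp := hpos v hv hvv hvt (by omega)
      rw [hpar', Nat.add_sub_cancel] at hp ⊢
      rw [Function.update_apply]
      split_ifs with h
      · exact Nat.one_pos
      · have hdd : d' ≠ d := by
          rintro rfl
          rw [horg] at horg'
          subst horg'
          omega
        rw [Function.update_of_ne hdd]
        exact hp
    simp only [wp_seq, wp_get, wp_sub, wp_put, Store.setReg_reg,
      Store.setReg_arr, Store.setArr_reg, Store.setArr_arr, reduceCtorEq, if_false, if_true,
      false_imp_iff, true_and, b1, b2, b3, b4, b5, b6, hx, hpar, Nat.add_sub_cancel]
    rw [hpar, Nat.add_sub_cancel] at hresd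
    refine ⟨8 * rk (σ.arr .org d), ⟨⟨σ.arr .org d, hOrg⟩, ?_⟩, by omega⟩
    obtain ⟨e, rfl | rfl⟩ := exists_edge hdD
    · have hef : e ∈ f' := by
        by_contra h
        rw [hR.tail, if_neg h] at hresd
        omega
      have hhead : G.head e = y := by
        rw [hL.mate_tail e e.2, hL.org_head e e.2] at horg
        exact Fin.ext horg
      refine ⟨f'.erase e, rfl, hvo, ?_, ?_, ?_, hkeep, rfl⟩
      · rw [hL.mate_tail e e.2]
        exact hR.erase (hP.sub hef)
      · have := hP.erase hef hhead
        convert this using 1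
        exact Fin.ext (hL.org_tail e e.2)
      -- The edge that loses flow ends in `y ≠ t`, so no edge into `t` does.
      · intro e' he' ht'
        refine Finset.mem_erase.2 ⟨?_, hmono e' he' ht'⟩
        rintro rfl
        exact hyt (by rw [← hhead, ht'])
    · have hef : e ∈ A ∧ e ∉ f' := by
        by_contra h
        rw [hR.head, if_neg h] at hresd
        omega
      have htail : G.tail e = y := by
        rw [hL.mate_head e e.2, hL.org_tail e e.2] at horg
        exact Fin.ext horg
      refine ⟨insert e f', rfl, hvo, ?_, ?_, ?_, hkeep, rfl⟩
      · rw [hL.mate_head e e.2]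
        exact hR.insert e
      · have := hP.insert hef.1 hef.2 htail (fun h => hyt (by rw [h]))
        convert this using 1
        exact Fin.ext (hL.org_head e e.2)
      · exact fun e' he' ht' => Finset.mem_insert_of_mem (hmono e' he' ht')
  · simp only [Store.setReg_reg, Store.setReg_arr, Store.setArr_reg, Store.setArr_arr,
      reduceCtorEq, if_false, if_true, h0, h1, true_and]
    refine ⟨w, f, rfl, hwv, hres, hf.pending w, fun _ h _ => h, ?_, rfl⟩
    intro v hv hvv hvt _
    obtain ⟨d, hpar, -, hr, -⟩ := htree.tree v hv hvv hvt
    rwa [hpar]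
  · rintro τ T ⟨N', ⟨-, b2, -, -, -, b6, y, f', hx, hy, hR, hP, hmono, -, rfl⟩, hlt, hT⟩
    have hrk := htree.rk_lt w w.2 hwv
    have hyt : y = t := by
      by_contra h
      obtain ⟨d, hpar, -⟩ := htree.tree y y.2 hy (fun h' => h (Fin.ext h'))
      omega
    subst hyt
    exact ⟨by omega, b6, f', hR, hP.isFlow, hmono⟩

end RAM

namespace RAM

variable {n m : ℕ} {G : MDigraph (Fin n) (Fin m)}

/-! ## Rounds -/

/-- The unvisited vertices. -/
def unvisited (n : ℕ) (vis : ℕ → ℕ) : Finset (Fin n) :=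
  Finset.univ.filter fun v => vis v = 0

theorem mem_unvisited {vis : ℕ → ℕ} {v : Fin n} : v ∈ unvisited n vis ↔ vis v = 0 := by
  simp [unvisited]

section SearchClosed

variable {arr : Arr → ℕ → ℕ} {A f : Finset (Fin m)} {t : Fin n} {tok vis : ℕ → ℕ}

theorem SearchClosed.tight (hL : Loaded G m arr) (hR : Residual A f (arr .res))
    (h : SearchClosed n (2 * m) (arr .org) (arr .mate) (arr .res) tok t vis) :
    G.Tight A f t (fun v => tok v) (unvisited n vis) := by
  refine ⟨fun e he ht hh => ?_, fun e he hh => ?_, fun y hy hyt => ?_⟩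
  · by_contra hef
    rw [mem_unvisited] at ht hh
    have := h.closed (2 * e + 1) (by omega) (by rw [hR.head, if_pos ⟨he, hef⟩]; omega)
      (by rw [hL.org_head e e.2]; omega)
    rw [hL.mate_head e e.2, hL.org_tail e e.2] at this
    omega
  · rw [mem_unvisited] at hh ⊢
    by_contra ht
    have := h.closed (2 * e) (by omega) (by rw [hR.tail, if_pos he]; omega)
      (by rw [hL.org_tail e e.2]; omega)
    rw [hL.mate_tail e e.2, hL.org_head e e.2] at this
    omega
  · rw [mem_unvisited] at hy
    exact h.clean y y.2 (by omega) (fun h' => hyt (Fin.ext h'))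

/-- The complement of a tight set contains `t` and is closed under the search, so it contains every
visited vertex. -/
theorem SearchClosed.maximal (hL : Loaded G m arr) (hR : Residual A f (arr .res))
    (h : SearchClosed n (2 * m) (arr .org) (arr .mate) (arr .res) tok t vis) {S : Finset (Fin n)}
    (htS : t ∉ S) (hS : G.Tight A f t (fun v => tok v) S) : S ⊆ unvisited n vis := by
  intro v hv
  rw [mem_unvisited]
  by_contra hvis
  refine h.minimal {x | ∀ hx : x < n, ⟨x, hx⟩ ∉ S} (fun _ => htS) ?_ v v.2 (by omega) v.2 hv
  intro d hd hr ho hx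
  obtain ⟨e, rfl | rfl⟩ := exists_edge hd
  · have hef : e ∈ f := by
      by_contra hef
      rw [hR.tail, if_neg hef] at hr
      omega
    have e1 : (⟨arr .org (arr .mate (2 * e)), hx⟩ : Fin n) = G.head e :=
      Fin.ext (by simp only [hL.mate_tail e e.2, hL.org_head e e.2])
    rw [e1]
    intro hh
    have := ho (by rw [hL.org_tail e e.2]; exact (G.tail e).2)
    simp only [hL.org_tail e e.2, Fin.eta] at this
    exact this (hS.2.1 e hef hh)
  · have hef : e ∈ A ∧ e ∉ f := by
      by_contra hef
      rw [hR.head, if_neg hef] at hr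
      omega
    have e1 : (⟨arr .org (arr .mate (2 * e + 1)), hx⟩ : Fin n) = G.tail e :=
      Fin.ext (by simp only [hL.mate_head e e.2, hL.org_tail e e.2])
    rw [e1]
    intro hh
    have := ho (by rw [hL.org_head e e.2]; exact (G.head e).2)
    simp only [hL.org_head e e.2, Fin.eta] at this
    exact hef.2 (hS.1 e hef.1 hh this)

end SearchClosed

/-- Give a token to the head of every edge that leaves the set of unvisited vertices. -/
def addTokens : Cmd :=
  forEdges .d .d2
    (.get .z .alive .d2 ;;
      .ite .zero .z
        (.get .v .org .d2 ;; .get .w .org .d ;; .get .z .vis .v ;;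
          .ite .zero .z
            (.get .z .vis .w ;; .ite .z .one (.put .tok .v .one) .skip)
            .skip)
        .skip)

/-- A vertex entered by several such edges gets only one token. Also `t` may get one, which all
supply sums ignore. -/
theorem wp_addTokens {B M : ℕ} {σ : Store} {A : Finset (Fin m)} (hB : 2 * m ≤ B)
    (h1 : σ.reg .one = 1) (h0 : σ.reg .zero = 0) (hm2 : σ.reg .m2 = 2 * m)
    (hL : Loaded G m σ.arr) (hA : Alive A σ.arr) :
    WP B M addTokens σ fun τ T => T ≤ 12 * m + 2 ∧
      (∀ v : Fin n, τ.arr .tok v = σ.arr .tok v ∨ τ.arr .tok v = 1 ∧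
        ∃ e ∈ A, G.head e = v ∧ 0 < σ.arr .vis (G.head e) ∧ σ.arr .vis (G.tail e) = 0) ∧
      ∀ e ∈ A, 0 < σ.arr .vis (G.head e) → σ.arr .vis (G.tail e) = 0 →
        τ.arr .tok (G.head e) = 1 := by
  refine (wp_forEdges (c := 9) (fun j τ => (τ.reg .zero = 0 ∧ τ.arr .org = σ.arr .org ∧
    τ.arr .alive = σ.arr .alive ∧ τ.arr .vis = σ.arr .vis) ∧
    (∀ v : Fin n, τ.arr .tok v = σ.arr .tok v ∨ τ.arr .tok v = 1 ∧
      ∃ e ∈ A, G.head e = v ∧ 0 < σ.arr .vis (G.head e) ∧ σ.arr .vis (G.tail e) = 0) ∧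
    ∀ e ∈ A, (e : ℕ) < j → 0 < σ.arr .vis (G.head e) → σ.arr .vis (G.tail e) = 0 →
        τ.arr .tok (G.head e) = 1) (by decide) (by decide) (by decide)
    (by decide) hB ?_ ?_ ⟨⟨h0, rfl, rfl, rfl⟩, fun _ => Or.inl rfl, by simp⟩ hm2 h1).imp ?_
  · rintro e τ b ⟨⟨g1, g2⟩, g3⟩
    exact ⟨⟨⟨by simpa using g1, g2⟩, g3⟩, ⟨⟨by simpa using g1, g2⟩, g3⟩⟩
  · rintro j hj τ ⟨⟨g1, g2, g3, g4⟩, g5, g6⟩ hd hd2 _ hone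
    have ht := hL.org_tail ⟨j, hj⟩ hj
    have hh := hL.org_head ⟨j, hj⟩ hj
    have ha := hA ⟨j, hj⟩
    simp only at ht hh ha
    have hlast : ∀ e : Fin m, (e : ℕ) < j + 1 → ¬ (e : ℕ) < j → e = ⟨j, hj⟩ := fun e h h' =>
      Fin.ext (by simp only; omega)
    have hskip : ¬ (⟨j, hj⟩ ∈ A ∧ 0 < σ.arr .vis (G.head ⟨j, hj⟩) ∧
        σ.arr .vis (G.tail ⟨j, hj⟩) = 0) →
        ∀ e ∈ A, (e : ℕ) < j + 1 → 0 < σ.arr .vis (G.head e) → σ.arr .vis (G.tail e) = 0 →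
        τ.arr .tok (G.head e) = 1 := by
      intro hn e he hej k1 k2
      by_cases hlt : (e : ℕ) < j
      · exact g6 e he hlt k1 k2
      · have := hlast e hej hlt
        subst this
        exact absurd ⟨he, k1, k2⟩ hn
    simp only [wp_seq, wp_get, wp_ite, wp_put, wp_skip, Store.setReg_reg,
      Store.setReg_arr, Store.setArr_reg, Store.setArr_arr, reduceCtorEq, if_false, if_true,
      false_imp_iff, true_and, hd, hd2, hone, g1, g2, g3, g4, ht, hh, ha]
    refine ⟨fun hpos => ⟨fun hv => ⟨fun hw => ⟨⟨?_, ?_⟩, by omega⟩,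
      fun hw => ⟨⟨g5, hskip (by omega)⟩, by omega⟩⟩, fun hv => ⟨⟨g5, hskip (by omega)⟩, by omega⟩⟩,
      fun hpos => ⟨⟨g5, hskip ?_⟩, by omega⟩⟩
    · intro v
      have hjA : (⟨j, hj⟩ : Fin m) ∈ A := by
        by_contra h
        simp [h] at hpos
      by_cases hvj : v = G.head ⟨j, hj⟩
      · subst hvj
        exact Or.inr ⟨Function.update_self .., _, hjA, rfl, hv, by omega⟩
      · rw [Function.update_of_ne (fun h => hvj (Fin.ext h))]
        exact g5 v
    · intro e he hej k1 k2
      by_cases hvj : (G.head e : ℕ) = G.head ⟨j, hj⟩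
      · rw [hvj]
        exact Function.update_self ..
      · rw [Function.update_of_ne hvj]
        refine g6 e he ?_ k1 k2
        by_contra hlt
        exact hvj (by rw [hlast e hej hlt])
    · intro h
      simp [h.1] at hpos
  · rintro τ T ⟨⟨-, g5, g6⟩, hT⟩
    exact ⟨by omega, g5, fun e he => g6 e he e.2⟩

/-- The edges that remain when the edges into `t` without flow are deleted. -/
def keep (G : MDigraph (Fin n) (Fin m)) (A f : Finset (Fin m)) (t : Fin n) : Finset (Fin m) :=
  A.filter fun e => G.head e = t → e ∈ f

/-- Deleting the edges into `t` without flow is harmless. -/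
def Preserves (G : MDigraph (Fin n) (Fin m)) (s t : Fin n) (k : ℕ) (A f : Finset (Fin m)) :
    Prop :=
  ∀ F : Finset (Fin m), F.card ≤ k → G.Reach (A \ F) s t → G.Reach (keep G A f t \ F) s t

/-- The state of the computation for the vertex `t` after `i` rounds. -/
structure RoundState (G : MDigraph (Fin n) (Fin m)) (s t : Fin n) (k : ℕ) (A f : Finset (Fin m))
    (u : Fin n → ℕ) (i : ℕ) (tok : ℕ → ℕ) : Prop where
  flow : G.IsFlow A f t u
  le : i ≤ k + 1
  supply : (∑ y, if y ≠ t then u y + tok y else 0) ≤ (k + 1) * 2 ^ i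
  linked : i ≤ k → G.Linked A f s t k i fun y => u y + tok y
  preserves : i = k + 1 → Preserves G s t k A f

/-- One unit turns from unused to used, so `u + tok` is unchanged. -/
theorem RoundState.augment {s t : Fin n} {k : ℕ} {A f f' : Finset (Fin m)} {u : Fin n → ℕ} {i : ℕ}
    {tok : ℕ → ℕ} (h : RoundState G s t k A f u i tok) (hi : i ≤ k) {w : Fin n}
    (hw : 0 < tok w) (hf' : G.IsFlow A f' t fun y => u y + if y = w then 1 else 0)
    (hmono : ∀ e ∈ f, G.head e = t → e ∈ f') :
    RoundState G s t k A f' (fun y => u y + if y = w then 1 else 0) i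
      (Function.update tok w (tok w - 1)) := by
  have heq : ∀ y : Fin n, (u y + if y = w then 1 else 0) +
      Function.update tok w (tok w - 1) y = u y + tok y := by
    intro y
    by_cases hyw : y = w
    · subst hyw
      rw [Function.update_self, if_pos rfl]
      omega
    · rw [Function.update_of_ne (fun h' => hyw (Fin.ext h')), if_neg hyw]
      omega
  refine ⟨hf', h.le, ?_, fun _ => ?_, fun h' => by omega⟩
  · simp only [heq]
    exact h.supply
  · simp only [heq]
    exact (h.linked hi).mono hmono

theorem RoundState.nextRound {arr : Arr → ℕ → ℕ} {s t : Fin n} {k : ℕ} {A f : Finset (Fin m)}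
    {u : Fin n → ℕ} {i : ℕ} {tok tok' vis : ℕ → ℕ} (hst : s ≠ t) (hL : Loaded G m arr)
    (hR : Residual A f (arr .res))
    (h : RoundState G s t k A f u i tok) (hi : i ≤ k)
    (hS : SearchClosed n (2 * m) (arr .org) (arr .mate) (arr .res) tok t vis)
    (h1 : ∀ v : Fin n, tok' v = tok v ∨ tok' v = 1 ∧
        ∃ e ∈ A, G.head e = v ∧ 0 < vis (G.head e) ∧ vis (G.tail e) = 0)
    (h2 : ∀ e ∈ A, 0 < vis (G.head e) → vis (G.tail e) = 0 → tok' (G.head e) = 1) :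
    RoundState G s t k A f u (i + 1) tok' := by
  have htR : t ∉ unvisited n vis := by
    have := hS.root
    rw [mem_unvisited]
    omega
  have hT := hS.tight hL hR
  have hclean : ∀ v : Fin n, 0 < vis v → v ≠ t → tok v = 0 := fun v hv hvt =>
    hS.clean v v.2 hv fun h' => hvt (Fin.ext h')
  refine ⟨h.flow, by omega, ?_, fun hik => ?_, fun hik F hF hr => ?_⟩
  · have hsup := h.supply
    have hcut := h.flow.cutValue_eq htR hT
    unfold MDigraph.cutValue at hcut
    have hle : (∑ y : Fin n, if y ≠ t then u y else 0) ≤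
        ∑ y : Fin n, if y ≠ t then u y + tok y else 0 :=
      Finset.sum_le_sum fun y _ => by split_ifs <;> omega
    -- The new tokens number at most the edges leaving `R`. These are at most the cut value, which
    -- is the flow value and hence at most the old supply; so the supply at most doubles.
    have hexit : (∑ y : Fin n, if y ≠ t then u y + tok' y else 0) ≤
        (∑ y : Fin n, if y ≠ t then u y + tok y else 0) +
        ∑ e ∈ A, if G.tail e ∈ unvisited n vis ∧ G.head e ∉ unvisited n vis then 1 else 0 := by
      have hX : (∑ e ∈ A, if G.tail e ∈ unvisited n vis ∧ G.head e ∉ unvisited n vis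
          then 1 else 0) =
          (A.filter fun e => G.tail e ∈ unvisited n vis ∧ G.head e ∉ unvisited n vis).card :=
        (Finset.card_filter _ _).symm
      have hY : (∑ y : Fin n, if y ∈ (A.filter fun e => G.tail e ∈ unvisited n vis ∧
          G.head e ∉ unvisited n vis).image G.head then 1 else 0) =
          ((A.filter fun e => G.tail e ∈ unvisited n vis ∧
            G.head e ∉ unvisited n vis).image G.head).card := by
        rw [← Finset.card_filter]
        congr 1
        ext y
        simp
      rw [hX]
      refine le_trans ?_ (Nat.add_le_add_left (Finset.card_image_le (f := G.head)) _)
      rw [← hY, ← Finset.sum_add_distrib]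
      refine Finset.sum_le_sum fun y _ => ?_
      by_cases hyt : y = t
      · simp [hyt]
      · rw [if_pos hyt, if_pos hyt]
        rcases h1 y with h' | ⟨h', e, he, rfl, k1, k2⟩
        · omega
        · rw [if_pos, h', hclean _ k1 hyt]
          refine Finset.mem_image_of_mem _ (Finset.mem_filter.2 ⟨he, ?_, ?_⟩)
          · rwa [mem_unvisited]
          · rw [mem_unvisited]
            omega
    have hpow : (k + 1) * 2 ^ (i + 1) = 2 * ((k + 1) * 2 ^ i) := by ring
    omega
  · refine (h.linked hi).succ hst (by omega) h.flow htR hT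
      (fun S hS' hT' => hS.maximal hL hR hS' hT') ?_ ?_
    · intro y hyt
      rcases h1 y with h' | ⟨h', e, he, rfl, k1, k2⟩
      · omega
      · have := hclean _ k1 hyt
        omega
    · intro e he ht hh hht
      rw [mem_unvisited] at ht hh
      rw [h2 e he (by omega) ht, hclean _ (by omega) hht]
  · have hik' : i = k := by omega
    subst hik'
    exact (h.linked hi).preserves h.flow htR hT hF hr

end RAM

namespace RAM

variable {n m : ℕ} {G : MDigraph (Fin n) (Fin m)}

/-! ## Processing one vertex -/

/-- Reset the flow to zero, and give `k + 1` tokens to `s` and none to the other vertices. -/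
def resetFlow : Cmd :=
  forEdges .d .d2 (.get .z .alive .d2 ;; .put .res .d2 .z ;; .put .res .d .zero) ;;
    forVerts (.put .tok .v .zero) ;; .put .tok .s .k1

theorem wp_resetFlow {B M k : ℕ} {s : Fin n} {σ : Store} {A : Finset (Fin m)} (hB : 2 * m ≤ B)
    (hnB : n ≤ B) (h1 : σ.reg .one = 1) (h0 : σ.reg .zero = 0) (hn : σ.reg .n = n)
    (hm2 : σ.reg .m2 = 2 * m) (hs : σ.reg .s = s) (hk : σ.reg .k1 = k + 1)
    (hA : Alive A σ.arr) :
    WP B M resetFlow σ fun τ T => T ≤ 6 * m + 3 * n + 5 ∧ Residual A ∅ (τ.arr .res) ∧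
      ∀ v : Fin n, τ.arr .tok v = if v = s then k + 1 else 0 := by
  have hedges : WP B M
      (forEdges .d .d2 (.get .z .alive .d2 ;; .put .res .d2 .z ;; .put .res .d .zero)) σ
      fun τ T => (τ.reg .zero = 0 ∧ τ.arr .alive = σ.arr .alive ∧
        ∀ e : Fin m, (e : ℕ) < m → τ.arr .res (2 * e) = 0 ∧
          τ.arr .res (2 * e + 1) = if e ∈ A then 1 else 0) ∧ T ≤ (3 + 3) * m + 2 := by
    refine wp_forEdges (fun j τ => τ.reg .zero = 0 ∧ τ.arr .alive = σ.arr .alive ∧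
        ∀ e : Fin m, (e : ℕ) < j → τ.arr .res (2 * e) = 0 ∧
          τ.arr .res (2 * e + 1) = if e ∈ A then 1 else 0) (by decide) (by decide) (by decide)
      (by decide) hB ?_ ?_ ⟨h0, rfl, by simp⟩ hm2 h1
    · rintro e τ b ⟨g1, g2⟩
      exact ⟨⟨by simpa using g1, g2⟩, ⟨by simpa using g1, g2⟩⟩
    · rintro j hj τ ⟨g1, g2, g3⟩ hd hd2 _ _
      have ha := hA ⟨j, hj⟩
      simp only at ha
      simp only [wp_seq, wp_get, wp_put, Store.setReg_reg,
        Store.setReg_arr, Store.setArr_reg, Store.setArr_arr, reduceCtorEq, if_false, if_true,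
        false_imp_iff, true_and, hd, hd2, g1, g2, ha]
      refine ⟨fun e he => ?_, by omega⟩
      by_cases hej : (e : ℕ) = j
      · have : e = ⟨j, hj⟩ := Fin.ext hej
        subst this
        simp
      · rw [Function.update_of_ne (by omega), Function.update_of_ne (by omega),
          Function.update_of_ne (by omega), Function.update_of_ne (by omega)]
        exact g3 e (by omega)
  refine WP.seq hedges.frame ?_
  rintro τ T ⟨⟨⟨g1, -, g3⟩, hT⟩, hreg, -⟩
  have e1 := (hreg .one (by decide)).trans h1
  have e2 := (hreg .n (by decide)).trans hn
  have e3 := (hreg .s (by decide)).trans hs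
  have e4 := (hreg .k1 (by decide)).trans hk
  have hverts : WP B M (forVerts (.put .tok .v .zero)) τ fun ρ T =>
      (ρ.reg .zero = 0 ∧ ∀ v < n, ρ.arr .tok v = 0) ∧ T ≤ (1 + 2) * n + 2 := by
    refine wp_forVerts (fun j τ => τ.reg .zero = 0 ∧ ∀ v < j, τ.arr .tok v = 0) (by decide) hnB
      ?_ ?_ ⟨g1, by simp⟩ e2 e1
    · intro e τ b hI
      simpa using hI
    · intro e he τ hI hv _ _
      rw [wp_put]
      refine ⟨by simp, ⟨hI.1, fun v hve => ?_⟩, le_rfl⟩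
      simp only [Store.setArr_arr, if_true, hv, hI.1, Function.update_apply]
      split_ifs with h
      · rfl
      · exact hI.2 v (by omega)
  refine WP.seq hverts.frame ?_
  rintro ρ T' ⟨⟨⟨-, k2⟩, hT'⟩, hreg', harr'⟩
  have f3 := (hreg' .s (by decide)).trans e3
  have f4 := (hreg' .k1 (by decide)).trans e4
  have f5 := harr' .res (by decide)
  simp only [wp_put, reduceCtorEq, false_imp_iff, true_and, Store.setArr_arr, if_true, if_false,
    f3, f4, f5]
  refine ⟨by omega, ⟨fun e => ?_, fun e => ?_⟩, fun v => ?_⟩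
  · simp [(g3 e e.2).1]
  · simp [(g3 e e.2).2]
  · by_cases hv : v = s
    · simp [hv]
    · rw [Function.update_of_ne (fun h => hv (Fin.ext h)), if_neg hv, k2 v v.2]

theorem RoundState.start {s t : Fin n} {k : ℕ} {A : Finset (Fin m)} {tok : ℕ → ℕ} (hst : s ≠ t)
    (htok : ∀ v : Fin n, tok v = if v = s then k + 1 else 0) :
    RoundState G s t k A ∅ (fun _ => 0) 0 tok where
  flow := ⟨by simp, by simp, by simp⟩
  le := Nat.zero_le _
  supply := by
    have : ∀ y : Fin n, (if y ≠ t then 0 + tok y else 0) ≤ if y = s then k + 1 else 0 := by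
      intro y
      rw [htok]
      split_ifs <;> omega
    refine (Finset.sum_le_sum fun y _ => this y).trans ?_
    simp
  linked _ := MDigraph.linked_zero hst (by simp [htok])
  preserves h := by omega

/-- Compute `k + 1` maximum flows, with additional tokens between them. -/
def rounds : Cmd :=
  .sub .i .zero .zero ;; .while .i .k1
    (search ;; .ite .zero .fnd augment (addTokens ;; .add .i .i .one))

theorem RoundState.value_le {s t : Fin n} {k : ℕ} {A f : Finset (Fin m)} {u : Fin n → ℕ} {i : ℕ}
    {tok : ℕ → ℕ} (h : RoundState G s t k A f u i tok) :
    (∑ y, if y ≠ t then u y else 0) ≤ (k + 1) * 2 ^ (k + 1) := by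
  have h1 : (∑ y, if y ≠ t then u y else 0) ≤ ∑ y, if y ≠ t then u y + tok y else 0 :=
    Finset.sum_le_sum fun y _ => by split_ifs <;> omega
  have h2 : (k + 1) * 2 ^ i ≤ (k + 1) * 2 ^ (k + 1) :=
    Nat.mul_le_mul_left _ (Nat.pow_le_pow_right (by omega) h.le)
  exact h1.trans (h.supply.trans h2)

/-- Each pass raises either the flow value, bounded by `(k + 1) * 2 ^ (k + 1)`, or the round number,
bounded by `k + 1`; a pass costs at most `60 * (n + m) + 60`. -/
theorem wp_rounds {B M k : ℕ} {s t : Fin n} {σ : Store} {A : Finset (Fin m)} (hB : 2 * m ≤ B)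
    (hnB : n ≤ B) (hkB : k + 1 ≤ B) (h1 : σ.reg .one = 1) (h0 : σ.reg .zero = 0)
    (hn : σ.reg .n = n) (hm2 : σ.reg .m2 = 2 * m) (hk : σ.reg .k1 = k + 1) (ht : σ.reg .t = t)
    (hst : s ≠ t) (hL : Loaded G m σ.arr) (hA : Alive A σ.arr) (hR : Residual A ∅ (σ.arr .res))
    (hS : RoundState G s t k A ∅ (fun _ => 0) 0 (σ.arr .tok)) :
    WP B M rounds σ fun τ T =>
      T ≤ (60 * (n + m) + 60) * ((k + 1) * 2 ^ (k + 1) + (k + 1)) + 2 ∧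
      ∃ f u, Residual A f (τ.arr .res) ∧ RoundState G s t k A f u (k + 1) (τ.arr .tok) := by
  simp only [rounds, wp_seq, wp_sub]
  refine (wp_while (fun N τ => τ.reg .one = 1 ∧ τ.reg .zero = 0 ∧ τ.reg .n = n ∧
    τ.reg .m2 = 2 * m ∧ τ.reg .k1 = k + 1 ∧ τ.reg .t = t ∧ Loaded G m τ.arr ∧ Alive A τ.arr ∧
    ∃ f u, Residual A f (τ.arr .res) ∧ RoundState G s t k A f u (τ.reg .i) (τ.arr .tok) ∧
      N = (60 * (n + m) + 60) * (((k + 1) * 2 ^ (k + 1) - ∑ y, if y ≠ t then u y else 0) +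
        (k + 1 - τ.reg .i))) ?_ ((60 * (n + m) + 60) * ((k + 1) * 2 ^ (k + 1) + (k + 1)))
    _ ?_).imp ?_
  · rintro N τ ⟨b1, b2, b3, b4, b5, b6, b7, b8, f, u, hRes, hRS, rfl⟩ hlt
    have hik : τ.reg .i ≤ k := by omega
    refine WP.seq (wp_search b7.dartGraph hnB b1 b2 b3 (by rw [b6]; exact t.2)).frame ?_
    rintro ρ T ⟨⟨hT, hcase⟩, hreg, harr⟩
    have c1 := (hreg .one (by decide)).trans b1
    have c2 := (hreg .zero (by decide)).trans b2
    have c3 := (hreg .n (by decide)).trans b3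
    have c4 := (hreg .m2 (by decide)).trans b4
    have c5 := (hreg .k1 (by decide)).trans b5
    have c6 := (hreg .t (by decide)).trans b6
    have ci := hreg .i (by decide)
    have ares := harr .res (by decide)
    have atok := harr .tok (by decide)
    have aal := harr .alive (by decide)
    have aorg := harr .org (by decide)
    have amate := harr .mate (by decide)
    have c7 : Loaded G m ρ.arr :=
      b7.congr aorg amate (harr .first (by decide)) (harr .next (by decide))
    have c8 : Alive A ρ.arr := by
      unfold Alive
      rw [aal]
      exact b8
    rw [← ares] at hRes
    rw [← aorg, ← amate, ← ares, ← atok, b6] at hcase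
    rw [← atok, ← ci] at hRS
    rw [wp_ite, c2]
    rw [← ci] at hik ⊢
    have hval := hRS.value_le
    refine ⟨fun hf => ?_, fun hf => ?_⟩
    · obtain ⟨hf0, -⟩ | ⟨-, hwn, hwt, hwtok, hwv, rk, htree⟩ := hcase
      · omega
      refine (wp_augment (w := ⟨ρ.reg .w, hwn⟩) c7 hRes hRS.flow c1 c2 rfl hwv htree).frame.imp ?_
      rintro τ' T' ⟨⟨hT', htok, f', hR', hflow, hmono⟩, hreg', harr'⟩
      have hRS' := hRS.augment hik hwtok hflow hmono
      rw [← htok, ← hreg' .i (by decide)] at hRS'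
      have hval' := hRS'.value_le
      have hsum : (∑ y, if y ≠ t then (u y + if y = ⟨ρ.reg .w, hwn⟩ then 1 else 0) else 0) =
          (∑ y, if y ≠ t then u y else 0) + 1 := by
        have : ∀ y : Fin n, (if y ≠ t then (u y + if y = ⟨ρ.reg .w, hwn⟩ then 1 else 0) else 0) =
            (if y ≠ t then u y else 0) + if y = ⟨ρ.reg .w, hwn⟩ then 1 else 0 := by
          intro y
          by_cases hyt : y = t
          · subst hyt
            have : y ≠ ⟨ρ.reg .w, hwn⟩ := fun h => hwt (by rw [h])
            simp [this]
          · simp [hyt]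
        rw [Finset.sum_congr rfl fun y _ => this y, Finset.sum_add_distrib]
        simp
      refine ⟨_, ⟨(hreg' .one (by decide)).trans c1, (hreg' .zero (by decide)).trans c2,
        (hreg' .n (by decide)).trans c3, (hreg' .m2 (by decide)).trans c4,
        (hreg' .k1 (by decide)).trans c5, (hreg' .t (by decide)).trans c6,
        c7.congr (harr' .org (by decide)) (harr' .mate (by decide)) (harr' .first (by decide))
          (harr' .next (by decide)), ?_, f', _, hR', hRS', rfl⟩, ?_⟩
      · unfold Alive
        rw [harr' .alive (by decide)]
        exact c8
      · rw [hsum] at hval' ⊢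
        rw [hreg' .i (by decide)]
        generalize hX : (∑ y, if y ≠ t then u y else 0) = X at hval hval' ⊢
        generalize (k + 1) * 2 ^ (k + 1) = Y at hval hval' ⊢
        have : Y - X + (k + 1 - ρ.reg .i) = (Y - (X + 1) + (k + 1 - ρ.reg .i)) + 1 := by omega
        obtain ⟨C, hC⟩ : ∃ C, C = 60 * (n + m) + 60 := ⟨_, rfl⟩
        rw [this, ← hC, Nat.mul_succ]
        omega
    · obtain ⟨-, hSC⟩ | ⟨hf1, -⟩ := hcase
      swap
      · omega
      refine WP.seq (wp_addTokens hB c1 c2 c4 c7 c8).frame ?_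
      rintro τ' T' ⟨⟨hT', k1, k2⟩, hreg', harr'⟩
      have hRS' := hRS.nextRound hst c7 hRes hik hSC k1 k2
      have g1 := (hreg' .one (by decide)).trans c1
      have gi := hreg' .i (by decide)
      rw [wp_add, g1, gi]
      refine ⟨by omega, _, ⟨?_, ?_, ?_, ?_, ?_, ?_,
        c7.congr (harr' .org (by decide)) (harr' .mate (by decide)) (harr' .first (by decide))
          (harr' .next (by decide)), ?_, f, u, ?_, ?_, rfl⟩, ?_⟩
      · simpa using g1
      · simpa using (hreg' .zero (by decide)).trans c2
      · simpa using (hreg' .n (by decide)).trans c3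
      · simpa using (hreg' .m2 (by decide)).trans c4
      · simpa using (hreg' .k1 (by decide)).trans c5
      · simpa using (hreg' .t (by decide)).trans c6
      · unfold Alive
        rw [Store.setReg_arr, harr' .alive (by decide)]
        exact c8
      · rw [Store.setReg_arr, harr' .res (by decide)]
        exact hRes
      · simpa using hRS'
      · rw [Store.setReg_reg, if_pos rfl]
        generalize (∑ y, if y ≠ t then u y else 0) = X at hval ⊢
        generalize (k + 1) * 2 ^ (k + 1) = Y at hval ⊢
        have : Y - X + (k + 1 - ρ.reg .i) = (Y - X + (k + 1 - (ρ.reg .i + 1))) + 1 := by omega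
        obtain ⟨C, hC⟩ : ∃ C, C = 60 * (n + m) + 60 := ⟨_, rfl⟩
        rw [this, ← hC, Nat.mul_succ]
        omega
  · simp only [Store.setReg_reg, Store.setReg_arr, reduceCtorEq, if_false, if_true, h1, h0, hn,
      hm2, hk, ht, Nat.sub_self, true_and]
    exact ⟨hL, hA, ∅, _, hR, hS, by simp⟩
  · rintro τ T ⟨N', ⟨-, -, -, -, b5, -, -, -, f, u, hRes, hRS, -⟩, hlt, hT⟩
    have := hRS.le
    have hi : τ.reg .i = k + 1 := by omega
    rw [hi] at hRS
    exact ⟨by omega, f, u, hRes, hRS⟩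

/-- Delete the edges into `t` without flow. -/
def deleteEdges : Cmd :=
  forEdges .d .d2
    (.get .z .org .d2 ;;
      .ite .z .t .skip (.ite .t .z .skip
        (.get .z .res .d2 ;; .ite .zero .z (.put .alive .d2 .zero) .skip)))

/-- The residual value at the odd dart is positive exactly for edges of `A` without flow. -/
theorem wp_deleteEdges {B M : ℕ} {t : Fin n} {σ : Store} {A f : Finset (Fin m)} (hB : 2 * m ≤ B)
    (h1 : σ.reg .one = 1) (h0 : σ.reg .zero = 0) (hm2 : σ.reg .m2 = 2 * m) (ht : σ.reg .t = t)
    (hL : Loaded G m σ.arr) (hA : Alive A σ.arr) (hR : Residual A f (σ.arr .res)) :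
    WP B M deleteEdges σ fun τ T => T ≤ 10 * m + 2 ∧ Alive (keep G A f t) τ.arr := by
  refine (wp_forEdges (c := 7) (fun j τ => (τ.reg .zero = 0 ∧ τ.reg .t = t ∧
    τ.arr .org = σ.arr .org ∧ τ.arr .res = σ.arr .res) ∧
    ∀ e : Fin m, τ.arr .alive (2 * e + 1) =
      if e ∈ A ∧ ((e : ℕ) < j → G.head e = t → e ∈ f) then 1 else 0) (by decide) (by decide)
    (by decide) (by decide) hB ?_ ?_ ⟨⟨h0, ht, rfl, rfl⟩, fun e => by simp [hA e]⟩ hm2 h1).imp ?_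
  · rintro e τ b ⟨⟨g1, g2, g3⟩, g4⟩
    exact ⟨⟨⟨by simpa using g1, by simpa using g2, g3⟩, g4⟩,
      ⟨⟨by simpa using g1, by simpa using g2, g3⟩, g4⟩⟩
  · rintro j hj τ ⟨⟨g1, g2, g3, g4⟩, g5⟩ _ hd2 _ _
    have hh := hL.org_head ⟨j, hj⟩ hj
    have hr := hR.head ⟨j, hj⟩
    simp only at hh hr
    have hlast : ∀ e : Fin m, (e : ℕ) < j + 1 → ¬ (e : ℕ) < j → e = ⟨j, hj⟩ := fun e h h' =>
      Fin.ext (by simp only; omega)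
    have hskip : (⟨j, hj⟩ ∈ A → G.head ⟨j, hj⟩ = t → ⟨j, hj⟩ ∈ f) →
        ∀ e : Fin m, τ.arr .alive (2 * e + 1) =
          if e ∈ A ∧ ((e : ℕ) < j + 1 → G.head e = t → e ∈ f) then 1 else 0 := by
      intro hn e
      rw [g5]
      refine if_congr (and_congr_right fun heA => ⟨fun h hlt hht => ?_, fun h hlt => h (by omega)⟩)
        rfl rfl
      by_cases hlt' : (e : ℕ) < j
      · exact h hlt' hht
      · have := hlast e hlt hlt'
        subst this
        exact hn heA hht
    simp only [wp_seq, wp_get, wp_ite, wp_put, wp_skip, Store.setReg_reg,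
      Store.setReg_arr, Store.setArr_reg, Store.setArr_arr, reduceCtorEq, if_false, if_true,
      false_imp_iff, true_and, hd2, g1, g2, g3, g4, hh, hr]
    refine ⟨fun hlt => ⟨hskip ?_, by omega⟩, fun hlt => ⟨fun hlt' => ⟨hskip ?_, by omega⟩,
      fun hlt' => ⟨fun hpos => ⟨fun e => ?_, by omega⟩, fun hpos => ⟨hskip ?_, by omega⟩⟩⟩⟩
    · intro _ h
      rw [h] at hlt
      omega
    · intro _ h
      rw [h] at hlt'
      omega
    · have hjf : ⟨j, hj⟩ ∈ A ∧ ⟨j, hj⟩ ∉ f := by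
        by_contra h
        rw [if_neg h] at hpos
        omega
      have hjt : G.head ⟨j, hj⟩ = t := Fin.ext (by omega)
      by_cases hej : (e : ℕ) = j
      · have : e = ⟨j, hj⟩ := Fin.ext hej
        subst this
        rw [Function.update_self, if_neg]
        exact fun h => hjf.2 (h.2 (Nat.lt_succ_self j) hjt)
      · rw [Function.update_of_ne (by omega), g5]
        refine if_congr (and_congr_right fun heA =>
          ⟨fun h hlt => h (by omega), fun h hlt => h (by omega)⟩) rfl rfl
    · intro hA' _
      by_contra h
      rw [if_pos ⟨hA', h⟩] at hpos
      omega
  · rintro τ T ⟨⟨-, g5⟩, hT⟩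
    refine ⟨by omega, fun e => ?_⟩
    rw [g5]
    simp [keep]

/-- Reduce the number of edges into the head of the edge with the darts `a` and `a2`. -/
def process : Cmd :=
  .get .t .org .a2 ;; resetFlow ;; rounds ;; deleteEdges

theorem wp_process {B M k : ℕ} {s : Fin n} {σ : Store} {A : Finset (Fin m)} {e₀ : Fin m}
    (hB : 2 * m ≤ B) (hnB : n ≤ B) (hkB : k + 1 ≤ B) (h1 : σ.reg .one = 1) (h0 : σ.reg .zero = 0)
    (hn : σ.reg .n = n) (hm2 : σ.reg .m2 = 2 * m) (hk : σ.reg .k1 = k + 1) (hs : σ.reg .s = s)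
    (ha2 : σ.reg .a2 = 2 * e₀ + 1) (hst : s ≠ G.head e₀) (hL : Loaded G m σ.arr)
    (hA : Alive A σ.arr) :
    WP B M process σ fun τ T =>
      T ≤ (60 * (n + m) + 60) * ((k + 1) * 2 ^ (k + 1) + (k + 1)) + 16 * m + 3 * n + 10 ∧
      ∃ f, Alive (keep G A f (G.head e₀)) τ.arr ∧ Preserves G s (G.head e₀) k A f ∧
        (G.inEdges f (G.head e₀)).card ≤ (k + 1) * 4 ^ (k + 1) := by
  have ht := hL.org_head e₀ e₀.2
  simp only [process, wp_seq (p := .get .t .org .a2), wp_get, reduceCtorEq, false_imp_iff,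
    true_and, ha2, ht]
  set σ' := σ.setReg .t (G.head e₀) with hσ'
  have hreset := wp_resetFlow (B := B) (M := M) (k := k) (s := s) (σ := σ') (A := A) hB hnB
    (by simpa [σ'] using h1) (by simpa [σ'] using h0) (by simpa [σ'] using hn)
    (by simpa [σ'] using hm2) (by simpa [σ'] using hs) (by simpa [σ'] using hk) hA
  refine WP.seq hreset.frame ?_
  rintro τ T ⟨⟨hT, hR, htok⟩, hreg, harr⟩
  have c1 : τ.reg .one = 1 := (hreg .one (by decide)).trans (by simpa [σ'] using h1)
  have c2 : τ.reg .zero = 0 := (hreg .zero (by decide)).trans (by simpa [σ'] using h0)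
  have c3 : τ.reg .n = n := (hreg .n (by decide)).trans (by simpa [σ'] using hn)
  have c4 : τ.reg .m2 = 2 * m := (hreg .m2 (by decide)).trans (by simpa [σ'] using hm2)
  have c5 : τ.reg .k1 = k + 1 := (hreg .k1 (by decide)).trans (by simpa [σ'] using hk)
  have c6 : τ.reg .t = G.head e₀ := (hreg .t (by decide)).trans (by simp [σ'])
  have c7 : Loaded G m τ.arr := hL.congr (harr .org (by decide)) (harr .mate (by decide))
    (harr .first (by decide)) (harr .next (by decide))
  have c8 : Alive A τ.arr := by
    unfold Alive
    rw [harr .alive (by decide)]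
    exact hA
  refine WP.seq (wp_rounds hB hnB hkB c1 c2 c3 c4 c5 c6 hst c7 c8 hR
    (RoundState.start hst htok)).frame ?_
  rintro ρ T' ⟨⟨hT', f, u, hRes, hRS⟩, hreg', harr'⟩
  have d7 : Loaded G m ρ.arr := c7.congr (harr' .org (by decide)) (harr' .mate (by decide))
    (harr' .first (by decide)) (harr' .next (by decide))
  have d8 : Alive A ρ.arr := by
    unfold Alive
    rw [harr' .alive (by decide)]
    exact c8
  refine (wp_deleteEdges hB ((hreg' .one (by decide)).trans c1)
    ((hreg' .zero (by decide)).trans c2) ((hreg' .m2 (by decide)).trans c4)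
    ((hreg' .t (by decide)).trans c6) d7 d8 hRes).imp ?_
  rintro μ T'' ⟨hT'', hA'⟩
  refine ⟨by omega, f, hA', hRS.preserves rfl, ?_⟩
  rw [hRS.flow.card_inEdges]
  -- The flow bound has `2 ^ (k + 1)` and is weakened to `4 ^ (k + 1)`.
  exact hRS.value_le.trans (Nat.mul_le_mul_left _ (Nat.pow_le_pow_left (by omega) _))

end RAM

namespace RAM

variable {n m : ℕ} {G : MDigraph (Fin n) (Fin m)}

/-! ## The main program -/

/-- `A` arises by legitimate deletions, and the heads of those among the first `j` edges that are
still present have small in-degree. -/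
structure Reduced (G : MDigraph (Fin n) (Fin m)) (s : Fin n) (k j : ℕ) (A : Finset (Fin m)) :
    Prop where
  deletions : G.ObtainedByDeletions s k A
  reach : ∀ F : Finset (Fin m), F.card ≤ k → ∀ v, G.Reach (Finset.univ \ F) s v →
    G.Reach (A \ F) s v
  head_ne : ∀ e ∈ A, G.head e ≠ s
  card_le : ∀ e ∈ A, (e : ℕ) < j → (G.inEdges A (G.head e)).card ≤ (k + 1) * 4 ^ (k + 1)

theorem Reduced.start (s : Fin n) (k : ℕ) :
    Reduced G s k 0 (Finset.univ \ G.inEdges Finset.univ s) where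
  deletions := Relation.ReflTransGen.refl
  reach _ _ _ h := MDigraph.reach_sdiff_inEdges_source h
  head_ne e he := by simpa [MDigraph.inEdges] using he
  card_le e _ he := by omega

theorem inEdges_mono {A A' : Finset (Fin m)} (h : A' ⊆ A) (v : Fin n) :
    (G.inEdges A' v).card ≤ (G.inEdges A v).card :=
  Finset.card_le_card (Finset.filter_subset_filter _ h)

/-- Deletions never raise in-degrees, so earlier bounds persist; edges into the new head all carry
flow. -/
theorem Reduced.keep {s : Fin n} {k : ℕ} {A f : Finset (Fin m)} {e₀ : Fin m}
    (h : Reduced G s k e₀ A) (he₀ : e₀ ∈ A) (hP : Preserves G s (G.head e₀) k A f)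
    (hf : (G.inEdges f (G.head e₀)).card ≤ (k + 1) * 4 ^ (k + 1)) :
    Reduced G s k (e₀ + 1) (keep G A f (G.head e₀)) := by
  have hsub : RAM.keep G A f (G.head e₀) ⊆ A := Finset.filter_subset _ _
  have hhead : ∀ e ∈ A, e ∉ RAM.keep G A f (G.head e₀) → G.head e = G.head e₀ := by
    intro e he hne
    by_contra hh
    exact hne (Finset.mem_filter.2 ⟨he, fun h' => absurd h' hh⟩)
  refine ⟨h.deletions.trans (MDigraph.deletionSteps_of_preserves (h.head_ne e₀ he₀) hsub hhead hP),
    fun F hF v hv => MDigraph.reach_of_preserves hhead (hP F hF) (h.reach F hF v hv),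
    fun e he => h.head_ne e (hsub he), fun e heA he => ?_⟩
  by_cases hej : (e : ℕ) < e₀
  · exact (inEdges_mono hsub _).trans (h.card_le e (hsub heA) hej)
  · have : e = e₀ := Fin.ext (by omega)
    subst this
    refine (Finset.card_le_card fun e' he' => ?_).trans hf
    obtain ⟨h1, h2⟩ := Finset.mem_filter.1 he'
    exact Finset.mem_filter.2 ⟨(Finset.mem_filter.1 h1).2 h2, h2⟩

theorem Reduced.skip {s : Fin n} {k : ℕ} {A : Finset (Fin m)} {e₀ : Fin m}
    (h : Reduced G s k e₀ A) (he₀ : e₀ ∉ A) : Reduced G s k (e₀ + 1) A := by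
  refine ⟨h.deletions, h.reach, h.head_ne, fun e heA he => h.card_le e heA ?_⟩
  have : (e : ℕ) ≠ e₀ := fun h' => he₀ (Fin.ext h' ▸ heA)
  omega

theorem Reduced.isFTRS {s : Fin n} {k j : ℕ} {A : Finset (Fin m)} (h : Reduced G s k j A) :
    G.IsFTRS s k A := fun F hF v =>
  ⟨h.reach F hF v, MDigraph.Reach.mono (Finset.sdiff_subset_sdiff (Finset.subset_univ _) le_rfl)⟩

/-- A vertex with a remaining incoming edge is the head of a treated edge; this is why a loop over
edges suffices. -/
theorem Reduced.card_inEdges_le {s : Fin n} {k : ℕ} {A : Finset (Fin m)} (h : Reduced G s k m A)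
    (v : Fin n) : (G.inEdges A v).card ≤ (k + 1) * 4 ^ (k + 1) := by
  obtain hv | ⟨e, he⟩ := (G.inEdges A v).eq_empty_or_nonempty
  · simp [hv]
  · obtain ⟨heA, rfl⟩ := Finset.mem_filter.1 he
    exact h.card_le e heA e.2

def writeOutput : Cmd :=
  .sub .v .zero .zero ;;
    forEdges .d .d2 (.get .z .alive .d2 ;; .put .io .v .z ;; .add .v .v .one)

theorem wp_writeOutput {B : ℕ} {σ : Store} {A : Finset (Fin m)} (hB : 2 * m ≤ B)
    (h1 : σ.reg .one = 1) (hm2 : σ.reg .m2 = 2 * m) (hA : Alive A σ.arr) :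
    WP B (2 * m) writeOutput σ fun τ T => T ≤ 6 * m + 3 ∧
      ∀ e : Fin m, τ.arr .io e = if e ∈ A then 1 else 0 := by
  refine wp_seq.2 (wp_sub.2 ?_)
  refine WP.imp (wp_forEdges (c := 3) (fun j τ => τ.reg .v = j ∧ τ.arr .alive = σ.arr .alive ∧
    ∀ e : Fin m, (e : ℕ) < j → τ.arr .io e = if e ∈ A then 1 else 0) (by decide) (by decide)
    (by decide) (by decide) hB ?_ ?_ ⟨by simp, rfl, by simp⟩ (by simpa using hm2)
    (by simpa using h1)) ?_
  · rintro e τ b ⟨g1, g2⟩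
    exact ⟨⟨by simpa using g1, g2⟩, ⟨by simpa using g1, g2⟩⟩
  · rintro j hj τ ⟨g1, g2, g3⟩ hd hd2 _ hone
    have ha := hA ⟨j, hj⟩
    simp only at ha
    simp only [wp_seq, wp_get, wp_put, wp_add, Store.setReg_reg,
      Store.setReg_arr, Store.setArr_reg, Store.setArr_arr, reduceCtorEq, if_false, if_true,
      false_imp_iff, true_and, forall_true_left, hd2, g1, g2, hone, ha]
    refine ⟨by omega, by omega, fun e he => ?_, by omega⟩
    by_cases hej : (e : ℕ) = j
    · have : e = ⟨j, hj⟩ := Fin.ext hej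
      subst this
      simp
    · rw [Function.update_of_ne hej]
      exact g3 e (by omega)
  · rintro τ T ⟨⟨-, -, g3⟩, hT⟩
    exact ⟨by omega, fun e => g3 e e.2⟩

/-- The main program. -/
def main : Cmd :=
  .const .one 1 ;; .const .zero 0 ;; .add .m2 .m .m ;; .add .k1 .k .one ;;
    forEdges .d .d2 loadEdge ;;
    forEdges .a .a2 (.get .z .alive .a2 ;; .ite .zero .z process .skip) ;;
    writeOutput

/-- The time for one edge. -/
def edgeTime (n m k : ℕ) : ℕ :=
  (60 * (n + m) + 60) * ((k + 1) * 2 ^ (k + 1) + (k + 1)) + 16 * m + 3 * n + 12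

theorem wp_main {B k : ℕ} {s : Fin n} {σ : Store} (hB : n + 2 * m + k + 2 ≤ B)
    (hn : σ.reg .n = n) (hm : σ.reg .m = m) (hk : σ.reg .k = k) (hs : σ.reg .s = s)
    (hio : ∀ e : Fin m, σ.arr .io (2 * e) = G.tail e ∧ σ.arr .io (2 * e + 1) = G.head e)
    (hzero : ∀ a, a ≠ .io → ∀ i, σ.arr a i = 0) :
    WP B (2 * m) main σ fun τ T => T ≤ (edgeTime n m k + 28) * m + 11 ∧
      ∃ A, Reduced G s k m A ∧ ∀ e : Fin m, τ.arr .io e = if e ∈ A then 1 else 0 := by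
  simp only [main, wp_seq (p := .const .one 1), wp_seq (p := .const .zero 0),
    wp_seq (p := .add .m2 .m .m), wp_seq (p := .add .k1 .k .one), wp_const, wp_add,
    Store.setReg_reg, reduceCtorEq, if_false, if_true, hm, hk]
  refine ⟨by omega, by omega, by omega, by omega, ?_⟩
  refine WP.seq (wp_loadEdges (G := G) (s := s) (by omega) (by simp) (by simp; omega)
    (by simpa using hs) (by simpa using hio) (by simpa using hzero)).frame ?_
  rintro τ T ⟨⟨hT, hL, hA⟩, hreg, harr⟩
  have c1 := hreg .one (by decide)
  have c2 := hreg .zero (by decide)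
  have c3 := hreg .n (by decide)
  have c4 := hreg .m2 (by decide)
  have c5 := hreg .k1 (by decide)
  have c6 := hreg .s (by decide)
  simp only [Store.setReg_reg, reduceCtorEq, if_false, if_true, hn, hs] at c1 c2 c3 c4 c5 c6
  have hloop : WP B (2 * m) (forEdges .a .a2 (.get .z .alive .a2 ;; .ite .zero .z process .skip))
      τ fun ρ T => (ρ.reg .zero = 0 ∧ ρ.reg .n = n ∧ ρ.reg .k1 = k + 1 ∧ ρ.reg .s = s ∧
        Loaded G m ρ.arr ∧ ∃ A, Alive A ρ.arr ∧ Reduced G s k m A) ∧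
        T ≤ (edgeTime n m k + 3) * m + 2 := by
    refine wp_forEdges (m := m) (c := edgeTime n m k) (fun j ρ => ρ.reg .zero = 0 ∧ ρ.reg .n = n ∧ ρ.reg .k1 = k + 1 ∧
      ρ.reg .s = s ∧ Loaded G m ρ.arr ∧ ∃ A, Alive A ρ.arr ∧ Reduced G s k j A) (by decide)
      (by decide) (by decide) (by decide) (by omega) ?_ ?_
      ⟨c2, c3, c5, c6, hL, _, hA, Reduced.start s k⟩ (by omega) c1
    · rintro e ρ b ⟨g1, g2, g3, g4, g5⟩
      exact ⟨⟨by simpa using g1, by simpa using g2, by simpa using g3, by simpa using g4, g5⟩,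
        ⟨by simpa using g1, by simpa using g2, by simpa using g3, by simpa using g4, g5⟩⟩
    · rintro j hj ρ ⟨g1, g2, g3, g4, g5, A, g6, g7⟩ ha ha2 hρm hρ1
      have hal := g6 ⟨j, hj⟩
      simp only at hal
      simp only [wp_seq (p := .get .z .alive .a2), wp_get, wp_ite, wp_skip, Store.setReg_reg,
        reduceCtorEq, if_false, if_true, false_imp_iff, true_and, ha2, hal, g1]
      refine ⟨fun hpos => ?_, fun hpos => ⟨⟨?_, ?_, ?_, g5, A, g6, ?_⟩, ?_⟩⟩
      · have hjA : (⟨j, hj⟩ : Fin m) ∈ A := by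
          by_contra h
          simp [h] at hpos
        refine WP.imp (WP.frame (wp_process (G := G) (k := k) (s := s) (A := A) (e₀ := ⟨j, hj⟩) (by omega)
          (by omega) (by omega) (by simpa using hρ1) (by simpa using g1) (by simpa using g2)
          (by simpa using hρm) (by simpa using g3) (by simpa using g4) (by simpa using ha2)
          (g7.head_ne _ hjA).symm g5 g6)) ?_
        rintro μ T' ⟨⟨hT', f, hA', hP, hcard⟩, hreg', harr'⟩
        refine ⟨⟨(hreg' .zero (by decide)).trans (by simpa using g1),
          (hreg' .n (by decide)).trans (by simpa using g2),
          (hreg' .k1 (by decide)).trans (by simpa using g3),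
          (hreg' .s (by decide)).trans (by simpa using g4),
          g5.congr (harr' .org (by decide)) (harr' .mate (by decide)) (harr' .first (by decide))
            (harr' .next (by decide)), _, hA', g7.keep hjA hP hcard⟩, ?_⟩
        unfold edgeTime
        omega
      · simpa using g2
      · simpa using g3
      · simpa using g4
      · refine g7.skip (e₀ := ⟨j, hj⟩) fun h => ?_
        simp [h] at hpos
      · unfold edgeTime
        omega
  refine WP.seq hloop.frame ?_
  rintro ρ T' ⟨⟨⟨-, -, -, -, -, A, hA', hRed⟩, hT'⟩, hreg', -⟩
  refine (wp_writeOutput (by omega) ((hreg' .one (by decide)).trans c1)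
    ((hreg' .m2 (by decide)).trans (c4.trans (by omega))) hA').imp ?_
  rintro μ T'' ⟨hT'', hout⟩
  refine ⟨?_, A, hRed, hout⟩
  rw [Nat.add_mul] at hT' ⊢
  omega

end RAM

namespace MDigraph

/-! ### Transport along isomorphisms of digraphs -/

section Iso

variable {V E V' E' : Type*} {G : MDigraph V E} {G' : MDigraph V' E'} {eV : V ≃ V'} {eE : E ≃ E'}
  {s : V} {k : ℕ} {A : Finset E}

/-- The bijections `eV` and `eE` form an isomorphism. -/
def IsIso (G : MDigraph V E) (G' : MDigraph V' E') (eV : V ≃ V') (eE : E ≃ E') : Prop :=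
  ∀ e, G'.tail (eE e) = eV (G.tail e) ∧ G'.head (eE e) = eV (G.head e)

theorem IsIso.symm (h : IsIso G G' eV eE) : IsIso G' G eV.symm eE.symm := by
  intro e
  have := h (eE.symm e)
  rw [eE.apply_symm_apply] at this
  simp [this]

theorem IsIso.reach_map (h : IsIso G G' eV eE) {u v : V} (hr : G.Reach A u v) :
    G'.Reach (A.map eE.toEmbedding) (eV u) (eV v) := by
  induction hr with
  | refl => exact Relation.ReflTransGen.refl
  | tail _ hxy ih =>
    obtain ⟨e, he, rfl, rfl⟩ := hxy
    exact ih.tail ⟨eE e, Finset.mem_map_of_mem _ he, (h e).1, (h e).2⟩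

theorem map_symm_map (A : Finset E) : (A.map eE.toEmbedding).map eE.symm.toEmbedding = A := by
  ext e
  simp

theorem map_map_symm (A : Finset E') : (A.map eE.symm.toEmbedding).map eE.toEmbedding = A := by
  ext e
  simp

theorem IsIso.reach_map_iff (h : IsIso G G' eV eE) {u v : V} :
    G'.Reach (A.map eE.toEmbedding) (eV u) (eV v) ↔ G.Reach A u v := by
  refine ⟨fun hr => ?_, h.reach_map⟩
  have := h.symm.reach_map hr
  rwa [map_symm_map, eV.symm_apply_apply, eV.symm_apply_apply] at this

variable [DecidableEq V] [DecidableEq V'] [DecidableEq E] [DecidableEq E']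

theorem map_sdiff_equiv (A B : Finset E) :
    (A \ B).map eE.toEmbedding = A.map eE.toEmbedding \ B.map eE.toEmbedding := by
  ext e
  simp

theorem IsIso.isCut_map_iff (h : IsIso G G' eV eE) {v : V} {X : Finset E} :
    G'.IsCut (A.map eE.toEmbedding) (eV s) (eV v) (X.map eE.toEmbedding) ↔ G.IsCut A s v X := by
  unfold IsCut
  rw [← map_sdiff_equiv, h.reach_map_iff, Finset.map_subset_map]

theorem IsIso.isImportantSeparator_of_map (h : IsIso G G' eV eE) {v : V} {X : Finset E}
    (hX : G'.IsImportantSeparator (A.map eE.toEmbedding) (eV s) (eV v) (X.map eE.toEmbedding)) :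
    G.IsImportantSeparator A s v X := by
  refine ⟨h.isCut_map_iff.1 hX.1, fun Y hY hc hsub => ?_⟩
  refine Finset.map_injective eE.toEmbedding
    (hX.2 _ (h.isCut_map_iff.2 hY) (by simpa using hc) fun u hu => ?_)
  unfold reachSet at hu ⊢
  rw [Set.mem_ofPred_eq, ← map_sdiff_equiv] at hu ⊢
  rw [← eV.apply_symm_apply u, h.reach_map_iff] at hu ⊢
  exact hsub hu

theorem IsIso.inEdges_map (h : IsIso G G' eV eE) (v : V) :
    G'.inEdges (A.map eE.toEmbedding) (eV v) = (G.inEdges A v).map eE.toEmbedding := by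
  ext e'
  obtain ⟨e, rfl⟩ := eE.surjective e'
  simp [inEdges, (h e).2]

theorem IsIso.deletionStep_map (h : IsIso G G' eV eE) {A B : Finset E}
    (hAB : G.DeletionStep s k A B) :
    G'.DeletionStep (eV s) k (A.map eE.toEmbedding) (B.map eE.toEmbedding) := by
  obtain ⟨v, hv, e, he, hX, rfl⟩ := hAB
  refine ⟨eV v, fun h' => hv (eV.injective h'), eE e, ?_, fun X' hX' hc he' => ?_, ?_⟩
  · rw [h.inEdges_map]
    exact Finset.mem_map_of_mem _ he
  · rw [← map_map_symm (eE := eE) X'] at hX'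
    refine hX _ (h.isImportantSeparator_of_map hX') (by simpa using hc) ?_
    rw [Finset.mem_map]
    exact ⟨eE e, he', by simp⟩
  · exact Finset.map_erase ..

theorem IsIso.obtainedByDeletions_map [Fintype E] [Fintype E'] (h : IsIso G G' eV eE)
    {H : Finset E} (hH : G.ObtainedByDeletions s k H) :
    G'.ObtainedByDeletions (eV s) k (H.map eE.toEmbedding) := by
  unfold ObtainedByDeletions at hH ⊢
  have hu : (Finset.univ : Finset E') = (Finset.univ : Finset E).map eE.toEmbedding := by
    ext e
    simp
  rw [hu, h.inEdges_map, ← map_sdiff_equiv]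
  induction hH with
  | refl => exact Relation.ReflTransGen.refl
  | tail _ hxy ih => exact ih.tail (h.deletionStep_map hxy)

theorem IsIso.isFTRS_map [Fintype E] [Fintype E'] (h : IsIso G G' eV eE)
    {H : Finset E} (hH : G.IsFTRS s k H) :
    G'.IsFTRS (eV s) k (H.map eE.toEmbedding) := by
  intro F hF v
  have hu : (Finset.univ : Finset E') = (Finset.univ : Finset E).map eE.toEmbedding := by
    ext e
    simp
  rw [hu, ← map_map_symm (eE := eE) F, ← map_sdiff_equiv, ← map_sdiff_equiv,
    ← eV.apply_symm_apply v, h.reach_map_iff, h.reach_map_iff]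
  exact hH _ (by simpa using hF) _

end Iso

end MDigraph

/-! ### The machine program on its input, and the numerical bounds -/

namespace RAM

/-- The initial contents of the registers and arrays. -/
def inputStore {n m : ℕ} (G : MDigraph (Fin n) (Fin m)) (s : Fin n) (k : ℕ) : Store where
  reg
    | .n => n
    | .m => m
    | .k => k
    | .s => s
    | _ => 0
  arr
    | .io => fun i => if i < 2 * m then (inputState G s k).mem i else 0
    | _ => fun _ => 0

theorem inputState_mem_lt {n m : ℕ} (G : MDigraph (Fin n) (Fin m)) (s : Fin n) (k i : ℕ) :
    (inputState G s k).mem i ≤ n := by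
  simp only [inputState]
  split_ifs
  · exact (G.tail _).2.le
  · exact (G.head _).2.le
  · exact Nat.zero_le _

/-- Memory beyond the `2 * m` input cells is zero, so the other arrays start as zero arrays. -/
theorem sim_inputState {n m : ℕ} (G : MDigraph (Fin n) (Fin m)) (s : Fin n) (k : ℕ) :
    Sim (n + 2 * m + k + 2) (2 * m) ((inputState G s k).setReg 40 (m + m)) (inputStore G s k) where
  reg r := by
    cases r <;> simp [inputState, inputStore, State.setReg, Reg.code, Reg.ctorIdx]
  base := by
    simp [State.setReg]
    omega
  io i hi := by
    simp [inputStore, State.setReg, hi]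
  arr a ha i := by
    have h1 : (inputStore G s k).arr a i = 0 := by
      cases a <;> first | rfl | exact absurd rfl ha
    have h2 : ¬ (2 * m + 16 * i + a.code) / 2 < m := by omega
    rw [h1]
    simp [inputState, State.setReg, h2]
  reg_le r := by
    have := s.2
    cases r <;> simp only [inputStore] <;> omega
  arr_le a i := by
    cases a <;> simp only [inputStore, Nat.zero_le]
    split_ifs
    · have := inputState_mem_lt G s k i
      omega
    · omega

/-- The base is at least `2`, so six of the seven factors give `64`, enough for every address. -/
theorem wordBound (n m k : ℕ) :
    2 * m + 16 * (n + 2 * m + k + 2) + 16 < (n + m + k + 2) ^ 7 := by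
  have h1 : 2 ^ 6 ≤ (n + m + k + 2) ^ 6 := Nat.pow_le_pow_left (by omega) 6
  have h2 := Nat.mul_le_mul_right (n + m + k + 2) h1
  rw [show (n + m + k + 2) ^ 7 = (n + m + k + 2) ^ 6 * (n + m + k + 2) from pow_succ _ _]
  omega

/-- The constant covers `8 * 420 = 3360` and the additive `8 * 11 + 1`; `n ≥ 1` absorbs the
constants in the time per edge. -/
theorem timeBound {n : ℕ} (hn : 0 < n) (m k : ℕ) :
    8 * ((edgeTime n m k + 28) * m + 11) + 1 ≤
      4000 * (4 ^ k * (k + 1) ^ 2 * (m + n) * m + 1) := by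
  have h1 : (k + 1) * 2 ^ (k + 1) + (k + 1) ≤ 3 * (4 ^ k * (k + 1) ^ 2) := by
    have h2 : 2 ^ k ≤ 4 ^ k := Nat.pow_le_pow_left (by omega) k
    have h3 : 1 ≤ 4 ^ k := Nat.one_le_pow _ _ (by omega)
    have h4 : k + 1 ≤ (k + 1) ^ 2 := Nat.le_self_pow (by omega) _
    have h5 := Nat.mul_le_mul h2 h4
    have h6 := Nat.mul_le_mul h3 h4
    have h7 : (k + 1) * 2 ^ (k + 1) = 2 * (2 ^ k * (k + 1)) := by ring
    omega
  have h2 : 1 ≤ 4 ^ k * (k + 1) ^ 2 :=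
    Nat.mul_pos (Nat.pow_pos (by omega)) (Nat.pow_pos (by omega))
  generalize 4 ^ k * (k + 1) ^ 2 = Q at h1 h2 ⊢
  have h3 : edgeTime n m k + 28 ≤ 420 * (Q * (m + n)) := by
    unfold edgeTime
    have h4 : 60 * (n + m) + 60 ≤ 120 * (m + n) := by omega
    have h5 := Nat.mul_le_mul h4 h1
    have h6 : 120 * (m + n) * (3 * Q) = 360 * (Q * (m + n)) := by ring
    have h7 := Nat.mul_le_mul_right (m + n) h2
    omega
  have h4 := Nat.mul_le_mul_right m h3
  rw [Nat.mul_assoc] at h4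
  omega

/-- The program of the machine. -/
def program : Prog := .seq (.add 40 1 1) main.compile

theorem exec_program {n m : ℕ} (G : MDigraph (Fin n) (Fin m)) (s : Fin n) (k : ℕ) :
    ∃ (H : Finset (Fin m)) (τ : State) (t : ℕ), Reduced G s k m H ∧
      Exec ((n + m + k + 2) ^ 7) program (inputState G s k) τ t ∧ HasOutput τ H ∧
      t ≤ 4000 * (4 ^ k * (k + 1) ^ 2 * (m + n) * m + 1) := by
  have hW := wordBound n m k
  have hio : ∀ e : Fin m, (inputStore G s k).arr .io (2 * e) = G.tail e ∧
      (inputStore G s k).arr .io (2 * e + 1) = G.head e := by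
    intro e
    have h1 : 2 * (e : ℕ) < 2 * m := by omega
    have h2 : 2 * (e : ℕ) + 1 < 2 * m := by omega
    have h3 : (2 * (e : ℕ) + 1) / 2 = e := by omega
    have h4 : (2 * (e : ℕ) + 1) % 2 = 1 := by omega
    constructor
    · simp [inputStore, inputState, h1]
    · simp [inputStore, inputState, h2, h3, h4]
  obtain ⟨σ, T, hex, hT, H, hH, hout⟩ := wp_main (G := G) (s := s) (k := k)
    (σ := inputStore G s k) le_rfl rfl rfl rfl rfl hio
    (fun a ha i => by cases a <;> first | rfl | exact absurd rfl ha)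
  obtain ⟨τ, t, hτ, hsim, ht⟩ := hex.compile hW _ (sim_inputState G s k)
  have hpre : Exec ((n + m + k + 2) ^ 7) (.add 40 1 1) (inputState G s k)
      ((inputState G s k).setReg 40 (m + m)) 1 :=
    Exec.add (inputState G s k) 40 1 1 (by simp [inputState]; omega)
  refine ⟨H, τ, 1 + t, hH, hpre.seq hτ, fun e => ?_, ?_⟩
  · rw [hsim.io e (by omega), hout]
  · have := timeBound (Fin.pos s) m k
    omega

end RAM

theorem corollary1 :
    (∀ (V : Type u) (E : Type v) [Fintype V] [DecidableEq V] [Fintype E] [DecidableEq E]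
        (G : MDigraph V E) (s : V) (k : ℕ),
      ∃ H : Finset E,
        G.ObtainedByDeletions s k H ∧ G.IsFTRS s k H ∧
        ∀ v : V, (G.inEdges H v).card ≤ (k + 1) * 4 ^ (k + 1)) ∧
    (∃ (p : RAM.Prog) (C c : ℕ),
      ∀ (n m : ℕ) (G : MDigraph (Fin n) (Fin m)) (s : Fin n) (k : ℕ),
        ∃ H : Finset (Fin m),
          G.ObtainedByDeletions s k H ∧ G.IsFTRS s k H ∧
          (∀ v : Fin n, (G.inEdges H v).card ≤ (k + 1) * 4 ^ (k + 1)) ∧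
          ∃ (τ : RAM.State) (t : ℕ),
            RAM.Exec ((n + m + k + 2) ^ c) p (RAM.inputState G s k) τ t ∧
            RAM.HasOutput τ H ∧
            t ≤ C * (4 ^ k * (k + 1) ^ 2 * (m + n) * m + 1)) := by
  constructor
  · intro V E _ _ _ _ G s k
    -- Existence is read off the program run on a copy of `G` with vertices and edges numbered.
    let eV := (Fintype.equivFin V).symm
    let eE := (Fintype.equivFin E).symm
    let G' : MDigraph (Fin (Fintype.card V)) (Fin (Fintype.card E)) :=
      ⟨fun e => eV.symm (G.tail (eE e)), fun e => eV.symm (G.head (eE e))⟩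
    have hiso : G'.IsIso G eV eE := fun e => by simp [G']
    obtain ⟨H, -, -, hH, -⟩ := RAM.exec_program G' (eV.symm s) k
    have h1 := hiso.obtainedByDeletions_map hH.deletions
    have h2 := hiso.isFTRS_map hH.isFTRS
    rw [eV.apply_symm_apply] at h1 h2
    refine ⟨H.map eE.toEmbedding, h1, h2, fun v => ?_⟩
    rw [← eV.apply_symm_apply v, hiso.inEdges_map, Finset.card_map]
    exact hH.card_inEdges_le _
  · refine ⟨RAM.program, 4000, 7, fun n m G s k => ?_⟩
    obtain ⟨H, τ, t, hH, hex, hout, ht⟩ := RAM.exec_program G s k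
    exact ⟨H, hH.deletions, hH.isFTRS, hH.card_inEdges_le, τ, t, hex, hout, ht⟩
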